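/- Fix a subextremal Reissner--Nordström--AdS black hole and a mass parameter: $M>0$, $Q\in\mathbb R$, $l>0$ such that $\Delta(r)=r^2-2Mr+\frac{r^4}{l^2}+Q^2$ has two positive roots $0<r_-<r_+$, and $\alpha<\frac94$. Put $\kappa_+=\frac12\frac{d}{dr}\big(\frac{\Delta}{r^2}\big)(r_+)$ and $\kappa_-=-\frac12\frac{d}{dr}\big(\frac{\Delta}{r^2}\big)(r_-)$. The tortoise coordinate satisfies $\frac{dr^*}{dr}=\frac{r^2}{\Delta}$, with $r^*(\infty)=\frac{\pi}{2}l$ on $(r_+,\infty)$ and $$r^*(r)=\tfrac1{2\kappa_+}\log|r-r_+|+f_*(r)\ \text{ on } (r_-,\infty)\setminus\{r_+\},\qquad r^*(r)=-\tfrac1{2\kappa_-}\log(r-r_-)+g_*(r)\ \text{ on } (r_-,r_+),$$ where $f_*$ is real-analytic on $(r_-,\infty)$ and $g_*$ is real-analytic on $(0,r_+)$. Consider for $\omega\in\mathbb C$, $\ell\in\mathbb Z_{\ge0}$ the radial equation $$\frac{\Delta}{r^4}\frac{d}{dr}\Big(\Delta\frac{dR}{dr}\Big)+\omega^2R-\ell(\ell+1)\frac{\Delta}{r^4}R+\frac{\alpha}{l^2}\frac{\Delta}{r^2}R=0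 .\qquad(*)$$ Let $R_{\mathcal H_R}=|r-r_+|^{-\frac{i\omega}{2\kappa_+}}\tilde R_{\mathcal H_R}$ be the solution of $(*)$ on $(r_-,\infty)\setminus\{r_+\}$ with $\tilde R_{\mathcal H_R}$ analytic on $(r_-,\infty)$ and $\tilde R_{\mathcal H_R}(r_+)=1$, and let $R_{\mathcal{CH}_L}=(r-r_-)^{\frac{i\omega}{2\kappa_-}}\tilde R_{\mathcal{CH}_L}$ and $R_{\mathcal{CH}_R}=(r-r_-)^{-\frac{i\omega}{2\kappa_-}}\tilde R_{\mathcal{CH}_R}$ be the solutions on $(r_-,r_+)$ with $\tilde R_{\mathcal{CH}_L},\tilde R_{\mathcal{CH}_R}$ analytic on $[r_-,r_+)$ and equal to $1$ at $r_-$. On $(r_-,r_+)$ set $$u_{\mathcal H_R}=\frac{r\,R_{\mathcal H_R}}{r_+e^{i\omega f_*(r_+)}},\quad u_{\mathcal{CH}_R}=\frac{r\,R_{\mathcal{CH}_R}}{r_-e^{-i\omega g_*(r_-)}},\quad u_{\mathcal{CH}_L}=\frac{r\,R_{\mathcal{CH}_L}}{r_-e^{i\omega g_*(r_-)}},$$ so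 that $u_{\mathcal H_R}\sim e^{-i\omega r^*}$ as $r^*\to-\infty$, and $u_{\mathcal{CH}_R}\sim e^{i\omega r^*}$, $u_{\mathcal{CH}_L}\sim e^{-i\omega r^*}$ as $r^*\to\infty$. The transmission coefficient $\mathfrak T(\omega,\ell)$ and the reflection coefficient $\mathfrak R(\omega,\ell)$ are defined by $$u_{\mathcal H_R}=\mathfrak R(\omega,\ell)\,u_{\mathcal{CH}_R}+\mathfrak T(\omega,\ell)\,u_{\mathcal{CH}_L}\quad\text{on }(r_-,r_+).$$ Call $\omega$ a quasinormal frequency for $\ell$ if $(*)$ has a nontrivial solution $R\in C^\infty(r_+,\infty)$ of the form $R=(r-r_+)^{-\frac{i\omega}{2\kappa_+}}\tilde R$, with $\tilde R$ extending smoothly to $(r_-,\infty)$ and $\tilde R(r_+)=1$, such that $\lim_{r\to\infty}r^{\frac32-\sqrt{\frac94-\alpha}}R(r)=0$. **Statement.** For all $a,b,C,c>0$ there are $\delta>0$ and $L\in\mathbb N$, depending only on $M,Q,l,\alpha,a,b,C,c$, such that the following holds. Let $(\omega_\ell)_{\ell\ge\ell_0}$ be a sequence such that, for every $\ell\ge\ell_0$,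 $\omega_\ell$ is a quasinormal frequency for $\ell$ with $$a\,\ell\le\operatorname{Re}\omega_\ell\le b\,\ell,\qquad 0<-\operatorname{Im}\omega_\ell\le C e^{-c\ell}.$$ Then $|\mathfrak T(\omega_\ell,\ell)|\ge\delta$ for every $\ell\ge\max(\ell_0,L)$. -/

import Mathlib

open scoped Topology

noncomputable section

/-- Parameters of a subextremal Reissner-Nordström-AdS black hole together with the Klein-Gordon
mass parameter `α` below the Breitenlohner-Freedman bound. The numbers `rm < rp` are the two
positive roots of `Δ`; as `Δ` is strictly convex on the real line, they are determined by
`(M, Q, l)`. (The existence of two positive roots forces `Q ≠ 0`.) -/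
structure RNAdS where
  M : ℝ
  Q : ℝ
  l : ℝ
  α : ℝ
  rm : ℝ
  rp : ℝ
  M_pos : 0 < M
  l_pos : 0 < l
  α_lt : α < 9 / 4
  rm_pos : 0 < rm
  rm_lt_rp : rm < rp
  root_rm : rm ^ 2 - 2 * M * rm + rm ^ 4 / l ^ 2 + Q ^ 2 = 0
  root_rp : rp ^ 2 - 2 * M * rp + rp ^ 4 / l ^ 2 + Q ^ 2 = 0

namespace RNAdS

/-- `Δ(r) = r² - 2Mr + r⁴/l² + Q²`. -/
def Δ (p : RNAdS) (r : ℝ) : ℝ := r ^ 2 - 2 * p.M * r + r ^ 4 / p.l ^ 2 + p.Q ^ 2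

/-- Surface gravity of the event horizon, `κ₊ = (1/2) (Δ/r²)'(r₊)`. -/
def κp (p : RNAdS) : ℝ := (p.rp - p.M + 2 * p.rp ^ 3 / p.l ^ 2) / p.rp ^ 2

/-- Surface gravity of the Cauchy horizon, `κ₋ = -(1/2) (Δ/r²)'(r₋)`. -/
def κm (p : RNAdS) : ℝ := -((p.rm - p.M + 2 * p.rm ^ 3 / p.l ^ 2) / p.rm ^ 2)

/-- Tortoise coordinate on the exterior `r > r₊`: `dr*/dr = r²/Δ` and `r*(∞) = π l / 2`. -/
def rstarExt (p : RNAdS) (r : ℝ) : ℝ :=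
  Real.pi / 2 * p.l - ∫ s in Set.Ioi r, s ^ 2 / p.Δ s

/-- The function `f_*` on `(r₋, ∞)`, analytic across `r₊`, with
`r*(r) = log (r - r₊) / (2 κ₊) + f_*(r)` for `r > r₊`. It is the primitive of
`r²/Δ - 1/(2 κ₊ (r - r₊))` (removable singularity at `r₊`) that agrees with `r*` at
`r = r₊ + 1`, where the logarithm vanishes. -/
def fstar (p : RNAdS) (r : ℝ) : ℝ :=
  p.rstarExt (p.rp + 1) +
    ∫ s in (p.rp + 1)..r, (s ^ 2 / p.Δ s - 1 / (2 * p.κp * (s - p.rp)))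

/-- Tortoise coordinate on the interior `r₋ < r < r₊`. -/
def rstarInt (p : RNAdS) (r : ℝ) : ℝ :=
  1 / (2 * p.κp) * Real.log (p.rp - r) + p.fstar r

/-- The function `g_*` on `(0, r₊)`, analytic across `r₋`, with
`r*(r) = - log (r - r₋) / (2 κ₋) + g_*(r)` on the interior. It is the primitive of
`r²/Δ + 1/(2 κ₋ (r - r₋))` (removable singularity at `r₋`) for which this identity holds at
the midpoint of `(r₋, r₊)`. -/
def gstar (p : RNAdS) (r : ℝ) : ℝ :=
  p.rstarInt ((p.rm + p.rp) / 2) + 1 / (2 * p.κm) * Real.log ((p.rm + p.rp) / 2 - p.rm) +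
    ∫ s in ((p.rm + p.rp) / 2)..r, (s ^ 2 / p.Δ s + 1 / (2 * p.κm * (s - p.rm)))

/-- `R` is a (`C²`) solution on the open set `s` of the radial equation
`(Δ/r⁴) (Δ R')' + ω² R - ℓ(ℓ+1) (Δ/r⁴) R + (α/l²) (Δ/r²) R = 0`. -/
def SolvesRadial (p : RNAdS) (ω : ℂ) (ℓ : ℕ) (R : ℝ → ℂ) (s : Set ℝ) : Prop :=
  ContDiffOn ℝ 2 R s ∧
  ∀ r ∈ s,
    ((p.Δ r / r ^ 4 : ℝ) : ℂ) * deriv (fun x : ℝ => (p.Δ x : ℂ) * deriv R x) r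
      + ω ^ 2 * R r
      - (ℓ : ℂ) * ((ℓ : ℂ) + 1) * ((p.Δ r / r ^ 4 : ℝ) : ℂ) * R r
      + ((p.α / p.l ^ 2 * (p.Δ r / r ^ 2) : ℝ) : ℂ) * R r = 0

/-- Solution `R_{H_R} = |r - r₊|^{-iω/(2κ₊)} R̃` with `R̃` analytic on `(r₋, ∞)`, `R̃(r₊) = 1`. -/
def IsRHR (p : RNAdS) (ω : ℂ) (ℓ : ℕ) (R : ℝ → ℂ) : Prop :=
  p.SolvesRadial ω ℓ R (Set.Ioi p.rm \ {p.rp}) ∧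
  ∃ Rt : ℝ → ℂ, AnalyticOnNhd ℝ Rt (Set.Ioi p.rm) ∧ Rt p.rp = 1 ∧
    ∀ r ∈ Set.Ioi p.rm \ {p.rp},
      R r = ((|r - p.rp| : ℝ) : ℂ) ^ (-(Complex.I * ω / (2 * (p.κp : ℂ)))) * Rt r

/-- Solution `R_{CH_L} = e^{-iω r* + iω g_*} R̃ = (r - r₋)^{iω/(2κ₋)} R̃` with `R̃` analytic on
`[r₋, r₊)`, `R̃(r₋) = 1`. -/
def IsRCHL (p : RNAdS) (ω : ℂ) (ℓ : ℕ) (R : ℝ → ℂ) : Prop :=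
  p.SolvesRadial ω ℓ R (Set.Ioo p.rm p.rp) ∧
  ∃ Rt : ℝ → ℂ, AnalyticOnNhd ℝ Rt (Set.Ico p.rm p.rp) ∧ Rt p.rm = 1 ∧
    ∀ r ∈ Set.Ioo p.rm p.rp,
      R r = ((r - p.rm : ℝ) : ℂ) ^ (Complex.I * ω / (2 * (p.κm : ℂ))) * Rt r

/-- Solution `R_{CH_R} = e^{iω r* - iω g_*} R̃ = (r - r₋)^{-iω/(2κ₋)} R̃` with `R̃` analytic on
`[r₋, r₊)`, `R̃(r₋) = 1`. -/
def IsRCHR (p : RNAdS) (ω : ℂ) (ℓ : ℕ) (R : ℝ → ℂ) : Prop :=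
  p.SolvesRadial ω ℓ R (Set.Ioo p.rm p.rp) ∧
  ∃ Rt : ℝ → ℂ, AnalyticOnNhd ℝ Rt (Set.Ico p.rm p.rp) ∧ Rt p.rm = 1 ∧
    ∀ r ∈ Set.Ioo p.rm p.rp,
      R r = ((r - p.rm : ℝ) : ℂ) ^ (-(Complex.I * ω / (2 * (p.κm : ℂ)))) * Rt r

open Classical in
/-- The solution `R_{H_R}(ω, ℓ, ·)` (and `0` if there is none). -/
def RHR (p : RNAdS) (ω : ℂ) (ℓ : ℕ) : ℝ → ℂ :=
  if h : ∃ R, p.IsRHR ω ℓ R then h.choose else 0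

open Classical in
/-- The solution `R_{CH_L}(ω, ℓ, ·)` (and `0` if there is none). -/
def RCHL (p : RNAdS) (ω : ℂ) (ℓ : ℕ) : ℝ → ℂ :=
  if h : ∃ R, p.IsRCHL ω ℓ R then h.choose else 0

open Classical in
/-- The solution `R_{CH_R}(ω, ℓ, ·)` (and `0` if there is none). -/
def RCHR (p : RNAdS) (ω : ℂ) (ℓ : ℕ) : ℝ → ℂ :=
  if h : ∃ R, p.IsRCHR ω ℓ R then h.choose else 0

/-- `u_{H_R}`, written as a function of `r ∈ (r₋, r₊)` instead of `r*`; it is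
`e^{-iω r*}(1 + o(1))` as `r* → -∞` (`r → r₊`). -/
def uHR (p : RNAdS) (ω : ℂ) (ℓ : ℕ) (r : ℝ) : ℂ :=
  (r : ℂ) / ((p.rp : ℂ) * Complex.exp (Complex.I * ω * (p.fstar p.rp : ℂ))) * p.RHR ω ℓ r

/-- `u_{CH_R}`, written as a function of `r ∈ (r₋, r₊)` instead of `r*`; it is
`e^{iω r*}(1 + o(1))` as `r* → ∞` (`r → r₋`). -/
def uCHR (p : RNAdS) (ω : ℂ) (ℓ : ℕ) (r : ℝ) : ℂ :=
  (r : ℂ) / ((p.rm : ℂ) * Complex.exp (-(Complex.I * ω * (p.gstar p.rm : ℂ)))) * p.RCHR ω ℓ r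

/-- `u_{CH_L}`, written as a function of `r ∈ (r₋, r₊)` instead of `r*`; it is
`e^{-iω r*}(1 + o(1))` as `r* → ∞` (`r → r₋`). -/
def uCHL (p : RNAdS) (ω : ℂ) (ℓ : ℕ) (r : ℝ) : ℂ :=
  (r : ℂ) / ((p.rm : ℂ) * Complex.exp (Complex.I * ω * (p.gstar p.rm : ℂ))) * p.RCHL ω ℓ r

open Classical in
/-- The transmission coefficient: the number `T` for which
`u_{H_R} = R u_{CH_R} + T u_{CH_L}` on the interior, for some `R` (and `0` if there is none). -/
def transmission (p : RNAdS) (ω : ℂ) (ℓ : ℕ) : ℂ :=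
  if h : ∃ T : ℂ, ∃ R : ℂ, ∀ r ∈ Set.Ioo p.rm p.rp,
      p.uHR ω ℓ r = R * p.uCHR ω ℓ r + T * p.uCHL ω ℓ r
  then h.choose else 0

/-- `ω` is a quasinormal frequency for the angular momentum `ℓ`: there is a smooth nontrivial
radial function `R` on the exterior `r > r₊` such that `e^{-iωt} R(r) Y_{ℓ,0}(θ)` solves the
Klein-Gordon equation (that is, `R` solves the radial equation), which is regular at the event
horizon and satisfies the Dirichlet condition at infinity. -/
def IsQuasinormalFrequency (p : RNAdS) (ω : ℂ) (ℓ : ℕ) : Prop :=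
  ∃ R : ℝ → ℂ, ContDiffOn ℝ ((⊤ : ℕ∞) : WithTop ℕ∞) R (Set.Ioi p.rp) ∧ (∃ r ∈ Set.Ioi p.rp, R r ≠ 0) ∧
    p.SolvesRadial ω ℓ R (Set.Ioi p.rp) ∧
    (∃ Rt : ℝ → ℂ, ContDiffOn ℝ ((⊤ : ℕ∞) : WithTop ℕ∞) Rt (Set.Ioi p.rm) ∧ Rt p.rp = 1 ∧
      ∀ r ∈ Set.Ioi p.rp,
        R r = ((r - p.rp : ℝ) : ℂ) ^ (-(Complex.I * ω / (2 * (p.κp : ℂ)))) * Rt r) ∧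
    Filter.Tendsto
      (fun r : ℝ => ((r ^ ((3 : ℝ) / 2 - Real.sqrt (9 / 4 - p.α)) : ℝ) : ℂ) * R r)
      Filter.atTop (𝓝 0)

end RNAdS

end

/-! The estimate takes place in the interior $(r_-,r_+)$. The Wronskian of two solutions of $(*)$ is
constant there, so pairing the defining relation of $\mathfrak T$ with $u_{\mathcal{CH}_R}$ gives
$|\mathfrak T|=|W(u_{\mathcal H_R},u_{\mathcal{CH}_R})|/(2|\omega|)$, and the task is to bound this
Wronskian below by a multiple of $\operatorname{Re}\omega$.

The elementary identity behind `four_mul_flux_mul_flux_le` bounds $|W|^2$ below by four times a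
product of fluxes $\operatorname{Im}(\bar u\,\partial_{r^*}u)$ taken at one point, with one of the
two signs reversed. For real $\omega$ these fluxes are conserved and equal to their horizon values
$-\omega$ and $+\omega$, so $|\mathfrak T|\ge1$.

For $\operatorname{Im}\omega\le0$ the fluxes are only almost conserved, and their error must be
controlled uniformly in $\ell$. Since $\Delta<0$ in the interior, the equation reads
$u''+(\omega^2+\mu A)u=0$ with $\mu=-\Delta/r^2>0$ and $A\approx\ell(\ell+1)/r^2>0$ for large
$\ell$. Once the oscillation at the horizon is split off, this sign makes an energy grow by at most
a factor independent of $\ell$ (`flux_estimate`). The flux error is then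
$O(|\operatorname{Im}\omega|\,\ell)$, small against $\operatorname{Re}\omega\ge a\ell$ once
$|\operatorname{Im}\omega|$ is small. Each horizon is joined to the midpoint this way
(`radial_flux_le`), at most half of each flux is lost, and `exists_wronskian_lower_bound` combines
the two.

The solutions and $\mathfrak T$ are defined by choice with default value $0$, so existence has to be
proved as well. A Frobenius series on the unit disk, moved by Möbius maps to regions free of other
singular points, produces each solution on its whole interval at once. -/

open scoped Topology

noncomputable section

/-! ### Power series on the open unit disk. -/

/-- A power series with coefficients `a` converges on the open unit disk. -/
def UnitDiskSummable (a : ℕ → ℂ) : Prop :=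
  ∀ s : ℝ, 0 < s → s < 1 → Summable fun n => ‖a n‖ * s ^ n

namespace UnitDiskSummable

variable {a : ℕ → ℂ}

theorem summable_norm (ha : UnitDiskSummable a) {z : ℂ} (hz : ‖z‖ < 1) :
    Summable fun n => ‖a n * z ^ n‖ := by
  obtain ⟨s, hs, hs1⟩ := exists_between hz
  refine (ha s ((norm_nonneg z).trans_lt hs) hs1).of_nonneg_of_le (fun n => norm_nonneg _) ?_
  intro n
  rw [norm_mul, norm_pow]
  gcongr

/-- A bound at a slightly larger radius `t` leaves the geometric factor $(s/t)^n$, which is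
summable. -/
theorem of_forall_bounded
    (h : ∀ s : ℝ, 0 < s → s < 1 → ∃ K, ∀ n, ‖a n‖ * s ^ n ≤ K) : UnitDiskSummable a := by
  intro s hs hs1
  obtain ⟨t, hst, ht1⟩ := exists_between hs1
  have ht : 0 < t := hs.trans hst
  obtain ⟨K, hK⟩ := h t ht ht1
  have hq : s / t < 1 := (div_lt_one ht).2 hst
  refine ((summable_geometric_of_lt_one (by positivity) hq).mul_left K).of_nonneg_of_le
    (fun n => by positivity) ?_
  intro n
  have e : ‖a n‖ * s ^ n = (‖a n‖ * t ^ n) * (s / t) ^ n := by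
    rw [div_pow]; field_simp
  rw [e]
  exact mul_le_mul_of_nonneg_right (hK n) (by positivity)

theorem exists_bound (ha : UnitDiskSummable a) {s : ℝ} (hs : 0 < s) (hs1 : s < 1) :
    ∃ K, 0 < K ∧ ∀ n, ‖a n‖ * s ^ n ≤ K := by
  refine ⟨∑' n, ‖a n‖ * s ^ n + 1, ?_, fun n => ?_⟩
  · have : 0 ≤ ∑' n, ‖a n‖ * s ^ n := tsum_nonneg fun n => by positivity
    linarith
  · have := (ha s hs hs1).le_tsum n (fun j _ => by positivity)
    linarith

theorem deriv_coeff (ha : UnitDiskSummable a) :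
    UnitDiskSummable fun n => ((n : ℂ) + 1) * a (n + 1) := by
  refine of_forall_bounded fun s hs hs1 => ?_
  obtain ⟨t, hst, ht1⟩ := exists_between hs1
  have ht : 0 < t := hs.trans hst
  obtain ⟨K, hK0, hK⟩ := ha.exists_bound ht ht1
  have hq : s / t < 1 := (div_lt_one ht).2 hst
  have hsum : Summable fun n : ℕ => (n : ℝ) ^ 1 * (s / t) ^ n :=
    summable_pow_mul_geometric_of_norm_lt_one 1
      (by rw [Real.norm_of_nonneg (by positivity)]; exact hq)
  refine ⟨K / s * ∑' n : ℕ, (n : ℝ) ^ 1 * (s / t) ^ n, fun n => ?_⟩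
  have h1 := hsum.le_tsum (n + 1) (fun j _ => by positivity)
  have e : ‖((n : ℂ) + 1) * a (n + 1)‖ * s ^ n
      = (‖a (n + 1)‖ * t ^ (n + 1)) / s * (((n + 1 : ℕ) : ℝ) ^ 1 * (s / t) ^ (n + 1)) := by
    have : ‖(n : ℂ) + 1‖ = (n : ℝ) + 1 := by
      have := Complex.norm_natCast (n + 1)
      push_cast at this
      exact this
    rw [norm_mul, this, div_pow, pow_succ s, pow_succ t]
    push_cast
    field_simp
  rw [e]
  have := hK (n + 1)
  gcongr

theorem hasDerivAt (ha : UnitDiskSummable a) {z : ℂ} (hz : ‖z‖ < 1) :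
    HasDerivAt (fun w => ∑' n, a n * w ^ n) (∑' n : ℕ, ((n : ℂ) + 1) * a (n + 1) * z ^ n) z := by
  obtain ⟨s, hs, hs1⟩ := exists_between hz
  have hs0 : 0 < s := (norm_nonneg z).trans_lt hs
  have hd := ha.deriv_coeff s hs0 hs1
  have hu : Summable fun n : ℕ => ‖(n : ℂ) * a n‖ * s ^ (n - 1) := by
    refine (summable_nat_add_iff 1).1 (hd.congr fun n => ?_)
    simp
  have key := hasDerivAt_tsum_of_isPreconnected (𝕜 := ℂ) (g := fun n w => a n * w ^ n)
    (g' := fun n w => a n * ((n : ℂ) * w ^ (n - 1))) hu (Metric.isOpen_ball (x := (0 : ℂ)) (ε := s))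
    (convex_ball (0 : ℂ) s).isPreconnected
    (fun n y _ => (hasDerivAt_pow n y).const_mul (a n))
    (fun n y hy => by
      have hy' : ‖y‖ ≤ s := by simpa using (Metric.mem_ball.1 hy).le
      rw [mul_left_comm, ← mul_assoc, norm_mul, norm_pow]
      gcongr)
    (Metric.mem_ball_self hs0) (ha.summable_norm (by simp)).of_norm
    (y := z) (by simpa using hs)
  have e : ∑' n : ℕ, a n * ((n : ℂ) * z ^ (n - 1))
      = ∑' n : ℕ, ((n : ℂ) + 1) * a (n + 1) * z ^ n := by
    have h1 : ∀ n : ℕ, ((n : ℂ) + 1) * a (n + 1) * z ^ n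
        = a (n + 1) * (((n + 1 : ℕ) : ℂ) * z ^ (n + 1 - 1)) := by
      intro n
      rw [Nat.add_sub_cancel]
      push_cast
      ring
    have h2 : Summable fun n : ℕ => a n * ((n : ℂ) * z ^ (n - 1)) :=
      (summable_nat_add_iff 1).1 ((ha.deriv_coeff.summable_norm hz).of_norm.congr h1)
    rw [h2.tsum_eq_zero_add, Nat.cast_zero, zero_mul, mul_zero, zero_add]
    exact tsum_congr fun n => (h1 n).symm
  rwa [e] at key

end UnitDiskSummable

theorem HasSum.congr_terms {f g : ℕ → ℂ} {a : ℂ} (hf : HasSum f a) (h : ∀ n, g n = f n) :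
    HasSum g a := by
  rwa [funext h]

/-! ### The Frobenius method on the unit disk. -/

/-- Taylor coefficients at `0`. -/
def taylorCoeffZero (f : ℂ → ℂ) (n : ℕ) : ℂ := ((n.factorial : ℂ))⁻¹ * iteratedDeriv n f 0

theorem taylorCoeffZero_zero (f : ℂ → ℂ) : taylorCoeffZero f 0 = f 0 := by
  simp [taylorCoeffZero]

theorem hasSum_taylorCoeffZero {f : ℂ → ℂ} (hf : DifferentiableOn ℂ f (Metric.ball 0 1)) {z : ℂ}
    (hz : ‖z‖ < 1) : HasSum (fun n => taylorCoeffZero f n * z ^ n) (f z) := by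
  have := Complex.hasSum_taylorSeries_on_ball hf (z := z) (by simpa using hz)
  have e : (fun n => taylorCoeffZero f n * z ^ n)
      = fun n : ℕ => ((n.factorial : ℂ))⁻¹ • (z - 0) ^ n • iteratedDeriv n f 0 := by
    funext n
    simp only [taylorCoeffZero, sub_zero, smul_eq_mul]
    ring
  rwa [e]

theorem unitDiskSummable_taylorCoeffZero {f : ℂ → ℂ}
    (hf : DifferentiableOn ℂ f (Metric.ball 0 1)) : UnitDiskSummable (taylorCoeffZero f) := by
  intro s hs hs1
  have := (hasSum_taylorCoeffZero hf (z := (s : ℂ))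
    (by rw [Complex.norm_real, Real.norm_of_nonneg hs.le]; exact hs1)).summable.norm
  refine this.congr fun n => ?_
  rw [norm_mul, norm_pow, Complex.norm_real, Real.norm_of_nonneg hs.le]

/-- Coefficients of the Frobenius solution of `z y'' + b y' + c y = 0` with exponent `0`. -/
def frobeniusCoeff (b c : ℕ → ℂ) : ℕ → ℂ
  | 0 => 1
  | n + 1 => -(∑ k : Fin (n + 1), ((k.1 : ℂ) * b (n + 1 - k.1) + c (n - k.1)) *
      frobeniusCoeff b c k.1) / (((n : ℂ) + 1) * ((n : ℂ) + b 0))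
termination_by n => n
decreasing_by exact k.2

theorem frobeniusCoeff_succ (b c : ℕ → ℂ) (n : ℕ) :
    frobeniusCoeff b c (n + 1) = -(∑ k ∈ Finset.range (n + 1),
      ((k : ℂ) * b (n + 1 - k) + c (n - k)) * frobeniusCoeff b c k) /
        (((n : ℂ) + 1) * ((n : ℂ) + b 0)) := by
  rw [frobeniusCoeff, Finset.sum_range]

/-- The denominators of the Frobenius recurrence are comparable to $n+1$: the threshold `N` makes
the shift `β` harmless, and the finitely many earlier terms are summed into the constant. As
division by zero gives $0$, no nonresonance condition is needed here. -/
theorem exists_inv_natCast_add_bound (β : ℂ) :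
    ∃ D, 0 < D ∧ ∀ n : ℕ, ((n : ℝ) + 1) / ‖(n : ℂ) + β‖ ≤ D := by
  obtain ⟨N, hN⟩ := exists_nat_gt (2 * ‖β‖ + 1)
  refine ⟨4 + ∑ k ∈ Finset.range N, ((k : ℝ) + 1) / ‖(k : ℂ) + β‖, by positivity, fun n => ?_⟩
  by_cases hn : n < N
  · have := Finset.single_le_sum (f := fun k : ℕ => ((k : ℝ) + 1) / ‖(k : ℂ) + β‖)
      (fun k _ => by positivity) (Finset.mem_range.2 hn)
    linarith
  · have hn' : (N : ℝ) ≤ n := by exact_mod_cast not_lt.1 hn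
    have h1 : ‖(n : ℂ)‖ ≤ ‖(n : ℂ) + β‖ + ‖β‖ := by
      simpa using norm_sub_le ((n : ℂ) + β) β
    rw [Complex.norm_natCast] at h1
    have h0 := norm_nonneg β
    have h2 : ((n : ℝ) + 1) / ‖(n : ℂ) + β‖ ≤ 4 := by
      rw [div_le_iff₀ (by linarith)]
      linarith
    have : 0 ≤ ∑ k ∈ Finset.range N, ((k : ℝ) + 1) / ‖(k : ℂ) + β‖ :=
      Finset.sum_nonneg fun k _ => by positivity
    linarith

/-- The product of the factors $1+D/(n+1)$ grows subexponentially: these factors are at most `τ`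
from index `N` on, and the constant absorbs what happens before. -/
theorem exists_geometric_bound {S : ℕ → ℝ} {D τ : ℝ} (hτ : 1 < τ) 
    (hS0 : ∀ n, 0 ≤ S n)
    (hS : ∀ n : ℕ, S (n + 1) ≤ (1 + D / ((n : ℝ) + 1)) * S n) : ∃ K, ∀ n, S n ≤ K * τ ^ n := by
  obtain ⟨N, hN⟩ := exists_nat_gt (D / (τ - 1))
  have hτ1 : 0 < τ - 1 := by linarith
  refine ⟨∑ k ∈ Finset.range (N + 1), S k, fun n => ?_⟩
  have hK : 0 ≤ ∑ k ∈ Finset.range (N + 1), S k := Finset.sum_nonneg fun k _ => hS0 k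
  induction n with
  | zero =>
    simpa using Finset.single_le_sum (f := S) (fun k _ => hS0 k)
      (Finset.mem_range.2 (Nat.succ_pos N))
  | succ n ih =>
    by_cases hn : n + 1 < N + 1
    · have h1 := Finset.single_le_sum (f := S) (fun k _ => hS0 k) (Finset.mem_range.2 hn)
      exact h1.trans (le_mul_of_one_le_right hK (one_le_pow₀ hτ.le))
    · have hn' : (N : ℝ) ≤ n := by exact_mod_cast (by omega : N ≤ n)
      have h2 : 1 + D / ((n : ℝ) + 1) ≤ τ := by
        rw [div_lt_iff₀ hτ1] at hN
        have : D / ((n : ℝ) + 1) ≤ τ - 1 := by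
          rw [div_le_iff₀ (by positivity)]
          nlinarith
        linarith
      calc S (n + 1) ≤ (1 + D / ((n : ℝ) + 1)) * S n := hS n
        _ ≤ τ * (_ * τ ^ n) := mul_le_mul h2 ih (hS0 n) (by linarith)
        _ = _ := by ring

/-- A majorant argument on the partial sums $S_n=\sum_{k\le n}|y_k|s^k$. Cauchy bounds for `b` and
`c` make the numerator of the recurrence $O((n+1)S_n)$, while its denominator is of size $(n+1)^2$,
so $S_{n+1}\le(1+D'/(n+1))S_n$. Subexponential growth at radius `s` then gives boundedness at every
smaller radius `t`. -/
theorem unitDiskSummable_frobeniusCoeff {b c : ℕ → ℂ} (hb : UnitDiskSummable b)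
    (hc : UnitDiskSummable c) (h0 : ∀ k : ℕ, (k : ℂ) + b 0 ≠ 0) :
    UnitDiskSummable (frobeniusCoeff b c) := by
  refine UnitDiskSummable.of_forall_bounded fun t ht ht1 => ?_
  obtain ⟨s, hts, hs1⟩ := exists_between ht1
  have hs : 0 < s := ht.trans hts
  obtain ⟨Cb, hCb0, hCb⟩ := hb.exists_bound hs hs1
  obtain ⟨Cc, hCc0, hCc⟩ := hc.exists_bound hs hs1
  obtain ⟨D, hD0, hD⟩ := exists_inv_natCast_add_bound (b 0)
  set y := frobeniusCoeff b c with hy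
  set S : ℕ → ℝ := fun n => ∑ k ∈ Finset.range (n + 1), ‖y k‖ * s ^ k with hS
  have hτ : 1 < s / t := (one_lt_div ht).2 hts
  have hstep : ∀ n : ℕ, ‖y (n + 1)‖ * s ^ (n + 1) ≤ (Cb + Cc) * D / ((n : ℝ) + 1) * S n := by
    intro n
    have hpos : 0 < ‖(n : ℂ) + b 0‖ := norm_pos_iff.2 (h0 n)
    have hnn : ‖(n : ℂ) + 1‖ = (n : ℝ) + 1 := by
      have := Complex.norm_natCast (n + 1)
      push_cast at this
      exact this
    have hsum : ‖∑ k ∈ Finset.range (n + 1), ((k : ℂ) * b (n + 1 - k) + c (n - k)) * y k‖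
        * s ^ (n + 1) ≤ (Cb + Cc) * ((n : ℝ) + 1) * S n := by
      calc _ ≤ (∑ k ∈ Finset.range (n + 1), ‖((k : ℂ) * b (n + 1 - k) + c (n - k)) * y k‖)
            * s ^ (n + 1) := by gcongr; exact norm_sum_le _ _
        _ ≤ _ := by
          rw [hS, Finset.sum_mul, Finset.mul_sum]
          refine Finset.sum_le_sum fun k hk => ?_
          have hkn : k ≤ n := Nat.lt_succ_iff.1 (Finset.mem_range.1 hk)
          have hkn' : (k : ℝ) ≤ n := by exact_mod_cast hkn
          have e1 : s ^ (n + 1) = s ^ (n + 1 - k) * s ^ k := by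
            rw [← pow_add]; congr 1; omega
          have e2 : s ^ (n + 1 - k) = s ^ (n - k) * s := by
            rw [← pow_succ]; congr 1; omega
          have hb' := hCb (n + 1 - k)
          have hc' := hCc (n - k)
          have h3 : ‖(k : ℂ) * b (n + 1 - k) + c (n - k)‖ * s ^ (n + 1 - k)
              ≤ (Cb + Cc) * ((n : ℝ) + 1) := by
            calc _ ≤ (k * ‖b (n + 1 - k)‖ + ‖c (n - k)‖) * s ^ (n + 1 - k) := by
                  gcongr
                  refine (norm_add_le _ _).trans ?_
                  rw [norm_mul, Complex.norm_natCast]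
              _ = k * (‖b (n + 1 - k)‖ * s ^ (n + 1 - k)) + ‖c (n - k)‖ * s ^ (n - k) * s := by
                  rw [e2]; ring
              _ ≤ k * Cb + Cc * 1 := by gcongr
              _ ≤ _ := by nlinarith
          rw [norm_mul, e1]
          calc _ = (‖(k : ℂ) * b (n + 1 - k) + c (n - k)‖ * s ^ (n + 1 - k)) * (‖y k‖ * s ^ k) := by
                ring
            _ ≤ _ := by gcongr
    rw [hy, frobeniusCoeff_succ, ← hy, norm_div, norm_neg, norm_mul, hnn, div_mul_eq_mul_div,
      div_le_iff₀ (by positivity)]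
    refine hsum.trans ?_
    have hDn := hD n
    rw [div_le_iff₀ hpos] at hDn
    have hSn : 0 ≤ S n := Finset.sum_nonneg fun k _ => by positivity
    calc _ ≤ (Cb + Cc) * (D * ‖(n : ℂ) + b 0‖) * S n := by gcongr
      _ = _ := by field_simp
  obtain ⟨K, hK⟩ := exists_geometric_bound (S := S) (D := (Cb + Cc) * D) hτ
    (fun n => Finset.sum_nonneg fun k _ => by positivity)
    (fun n => by
      have : S (n + 1) = S n + ‖y (n + 1)‖ * s ^ (n + 1) := Finset.sum_range_succ _ _
      rw [this, add_mul, one_mul]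
      exact add_le_add le_rfl (hstep n))
  refine ⟨K, fun n => ?_⟩
  have h1 : ‖y n‖ * s ^ n ≤ S n :=
    Finset.single_le_sum (f := fun k => ‖y k‖ * s ^ k) (fun k _ => by positivity)
      (Finset.mem_range.2 (Nat.lt_succ_self n))
  have h2 := h1.trans (hK n)
  rw [div_pow, ← mul_div_assoc, le_div_iff₀ (by positivity)] at h2
  have hsn : 0 < s ^ n := by positivity
  nlinarith

/-- The recurrence in Cauchy product form: this is the coefficient of $z^n$ in $zy''+by'+cy$. -/
theorem frobeniusCoeff_recurrence {b c : ℕ → ℂ} (h0 : ∀ k : ℕ, (k : ℂ) + b 0 ≠ 0) (n : ℕ) :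
    ((n : ℂ) * ((n : ℂ) + 1)) * frobeniusCoeff b c (n + 1)
      + ∑ k ∈ Finset.range (n + 1), b k * (((n - k : ℕ) : ℂ) + 1) * frobeniusCoeff b c (n - k + 1)
      + ∑ k ∈ Finset.range (n + 1), c k * frobeniusCoeff b c (n - k) = 0 := by
  have hn : ((n : ℂ) + 1) ≠ 0 := by exact_mod_cast Nat.succ_ne_zero n
  have h1 := frobeniusCoeff_succ b c n
  rw [eq_div_iff (mul_ne_zero hn (h0 n))] at h1
  rw [← Finset.sum_range_reflect (fun k => b k * (((n - k : ℕ) : ℂ) + 1) *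
      frobeniusCoeff b c (n - k + 1)), ← Finset.sum_range_reflect (fun k => c k *
      frobeniusCoeff b c (n - k))]
  have hsplit : ∑ j ∈ Finset.range (n + 1), b (n + 1 - 1 - j) *
        (((n - (n + 1 - 1 - j) : ℕ) : ℂ) + 1) * frobeniusCoeff b c (n - (n + 1 - 1 - j) + 1)
      = ∑ k ∈ Finset.range (n + 1), (k : ℂ) * b (n + 1 - k) * frobeniusCoeff b c k
        + ((n : ℂ) + 1) * b 0 * frobeniusCoeff b c (n + 1) := by
    -- The term with `b 0` is the one containing the unknown coefficient `n + 1`; together with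
    -- $n(n+1)$ it forms the denominator $(n+1)(n+b_0)$.
    have e : ∑ k ∈ Finset.range (n + 1), (k : ℂ) * b (n + 1 - k) * frobeniusCoeff b c k
        + ((n : ℂ) + 1) * b 0 * frobeniusCoeff b c (n + 1)
        = ∑ k ∈ Finset.range (n + 2), (k : ℂ) * b (n + 1 - k) * frobeniusCoeff b c k := by
      rw [Finset.sum_range_succ _ (n + 1)]
      simp
    rw [e, Finset.sum_range_succ' _ (n + 1)]
    simp only [Nat.cast_zero, zero_mul, add_zero]
    refine Finset.sum_congr rfl fun j hj => ?_
    have hj' : j ≤ n := Nat.lt_succ_iff.1 (Finset.mem_range.1 hj)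
    have e1 : n - (n + 1 - 1 - j) = j := by omega
    have e2 : n + 1 - 1 - j = n + 1 - (j + 1) := by omega
    rw [e1, e2]
    push_cast
    ring
  have hc2 : ∑ j ∈ Finset.range (n + 1), c (n + 1 - 1 - j) *
      frobeniusCoeff b c (n - (n + 1 - 1 - j))
      = ∑ k ∈ Finset.range (n + 1), c (n - k) * frobeniusCoeff b c k := by
    refine Finset.sum_congr rfl fun j hj => ?_
    have hj' : j ≤ n := Nat.lt_succ_iff.1 (Finset.mem_range.1 hj)
    have e1 : n - (n + 1 - 1 - j) = j := by omega
    rw [e1]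
    rfl
  rw [hsplit, hc2]
  simp only [add_mul, Finset.sum_add_distrib] at h1
  linear_combination h1

/-- Frobenius' theorem on the unit disk. -/
theorem exists_frobenius_unitDisk {b c : ℂ → ℂ} (hb : DifferentiableOn ℂ b (Metric.ball 0 1))
    (hc : DifferentiableOn ℂ c (Metric.ball 0 1)) (h0 : ∀ k : ℕ, (k : ℂ) + b 0 ≠ 0) :
    ∃ y y' y'' : ℂ → ℂ, y 0 = 1 ∧ ∀ z : ℂ, ‖z‖ < 1 → HasDerivAt y (y' z) z ∧
      HasDerivAt y' (y'' z) z ∧ z * y'' z + b z * y' z + c z * y z = 0 := by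
  have hbs := unitDiskSummable_taylorCoeffZero hb
  have hcs := unitDiskSummable_taylorCoeffZero hc
  set B := taylorCoeffZero b with hB
  set Cc := taylorCoeffZero c with hCc
  have h0' : ∀ k : ℕ, (k : ℂ) + B 0 ≠ 0 := by
    intro k; rw [hB, taylorCoeffZero_zero]; exact h0 k
  set a := frobeniusCoeff B Cc with ha
  have has : UnitDiskSummable a := unitDiskSummable_frobeniusCoeff hbs hcs h0'
  have has1 := has.deriv_coeff
  have has2 := has1.deriv_coeff
  refine ⟨fun z => ∑' n, a n * z ^ n, fun z => ∑' n : ℕ, ((n : ℂ) + 1) * a (n + 1) * z ^ n,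
    fun z => ∑' n : ℕ, ((n : ℂ) + 1) * (((n + 1 : ℕ) : ℂ) + 1) * a (n + 1 + 1) * z ^ n,
    ?_, fun z hz => ⟨has.hasDerivAt hz, ?_, ?_⟩⟩
  · simp only
    rw [tsum_eq_single 0 (fun n hn => by simp [hn])]
    simp [ha, frobeniusCoeff]
  · have := has1.hasDerivAt hz
    simp only [← mul_assoc] at this
    exact this
  · have s0 := (has.summable_norm hz)
    have s1 := (has1.summable_norm hz)
    have s2 := (has2.summable_norm hz)
    have sb := hbs.summable_norm hz
    have sc := hcs.summable_norm hz
    have p1 := hasSum_sum_range_mul_of_summable_norm sb s1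
    have p2 := hasSum_sum_range_mul_of_summable_norm sc s0
    rw [(hasSum_taylorCoeffZero hb hz).tsum_eq] at p1
    rw [(hasSum_taylorCoeffZero hc hz).tsum_eq] at p2
    have p0 : HasSum (fun n : ℕ => (n : ℂ) * ((n : ℂ) + 1) * a (n + 1) * z ^ n)
        (z * ∑' n : ℕ, ((n : ℂ) + 1) * (((n + 1 : ℕ) : ℂ) + 1) * a (n + 1 + 1) * z ^ n) := by
      rw [← hasSum_nat_add_iff' 1]
      have := s2.of_norm.hasSum.mul_left z
      simp only [← mul_assoc] at this ⊢
      simp only [Finset.range_one, Finset.sum_singleton, Nat.cast_zero, zero_mul, sub_zero]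
      refine this.congr_terms fun n => ?_
      push_cast
      ring
    have := (p0.add p1).add p2
    refine this.unique ?_
    refine (hasSum_zero (α := ℂ) (β := ℕ)).congr_terms fun n => ?_
    have hr := frobeniusCoeff_recurrence (c := Cc) h0' n
    rw [← ha] at hr
    have e1 : ∑ k ∈ Finset.range (n + 1), B k * z ^ k *
        ((((n - k : ℕ) : ℂ) + 1) * a (n - k + 1) * z ^ (n - k))
        = (∑ k ∈ Finset.range (n + 1), B k * (((n - k : ℕ) : ℂ) + 1) * a (n - k + 1)) * z ^ n := by
      rw [Finset.sum_mul]
      refine Finset.sum_congr rfl fun k hk => ?_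
      have hk' : k ≤ n := Nat.lt_succ_iff.1 (Finset.mem_range.1 hk)
      have : z ^ n = z ^ k * z ^ (n - k) := by rw [← pow_add]; congr 1; omega
      rw [this]; ring
    have e2 : ∑ k ∈ Finset.range (n + 1), Cc k * z ^ k * (a (n - k) * z ^ (n - k))
        = (∑ k ∈ Finset.range (n + 1), Cc k * a (n - k)) * z ^ n := by
      rw [Finset.sum_mul]
      refine Finset.sum_congr rfl fun k hk => ?_
      have hk' : k ≤ n := Nat.lt_succ_iff.1 (Finset.mem_range.1 hk)
      have : z ^ n = z ^ k * z ^ (n - k) := by rw [← pow_add]; congr 1; omega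
      rw [this]; ring
    rw [e1, e2]
    linear_combination (z ^ n) * hr

/-! ### Transport of the Frobenius solution by Möbius maps. -/

/-- The image of the unit disk under the Möbius transformation `z ↦ r₀ + β z / (1 - γ z)`. -/
def mobiusDisk (r₀ β γ : ℝ) : Set ℂ :=
  {r | ‖r - r₀‖ < ‖(β : ℂ) + γ * (r - r₀)‖}

theorem isOpen_mobiusDisk (r₀ β γ : ℝ) : IsOpen (mobiusDisk r₀ β γ) :=
  isOpen_lt (by fun_prop) (by fun_prop)

/-- Frobenius' theorem on the image of a disk under a Möbius transformation, for the
characteristic exponent `0`. -/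
theorem exists_frobenius_mobiusDisk {r₀ β γ : ℝ} (hβ : 0 < β) (hγ : |γ| ≤ 1) {B C : ℂ → ℂ}
    (hB : DifferentiableOn ℂ B (mobiusDisk r₀ β γ))
    (hC : DifferentiableOn ℂ C (mobiusDisk r₀ β γ)) (h0 : ∀ k : ℕ, (k : ℂ) + B r₀ ≠ 0) :
    ∃ Y Y' Y'' : ℂ → ℂ, Y r₀ = 1 ∧ ∀ r ∈ mobiusDisk r₀ β γ, HasDerivAt Y (Y' r) r ∧
      HasDerivAt Y' (Y'' r) r ∧ (r - r₀) * Y'' r + B r * Y' r + C r * Y r = 0 := by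
  have hβ0 : (β : ℂ) ≠ 0 := by exact_mod_cast hβ.ne'
  set ψ : ℂ → ℂ := fun z => r₀ + β * z / (1 - γ * z) with hψ
  have hden : ∀ z : ℂ, ‖z‖ < 1 → 1 - (γ : ℂ) * z ≠ 0 := by
    intro z hz h
    have h1 : ‖(γ : ℂ) * z‖ = 1 := by rw [← sub_eq_zero.1 h]; simp
    rw [norm_mul, Complex.norm_real, Real.norm_eq_abs] at h1
    nlinarith [norm_nonneg z, abs_nonneg γ]
  have hψU : ∀ z ∈ Metric.ball (0 : ℂ) 1, ψ z ∈ mobiusDisk r₀ β γ := by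
    intro z hz
    have hz1 : ‖z‖ < 1 := by simpa using hz
    have hd := hden z hz1
    have e1 : ψ z - r₀ = β / (1 - γ * z) * z := by simp only [hψ]; ring
    have e2 : (β : ℂ) + γ * (ψ z - r₀) = β / (1 - γ * z) := by
      rw [e1]; field_simp; ring
    change ‖_‖ < ‖_‖
    rw [e2, e1, norm_mul]
    exact mul_lt_of_lt_one_right (norm_pos_iff.2 (div_ne_zero hβ0 hd)) hz1
  have hψd : DifferentiableOn ℂ ψ (Metric.ball 0 1) := by
    intro z hz
    have hd := hden z (by simpa using hz)
    exact DifferentiableAt.differentiableWithinAt (by simp only [hψ]; fun_prop (disch := exact hd))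
  have hψ0 : ψ 0 = r₀ := by simp [hψ]
  have hlin : DifferentiableOn ℂ (fun z : ℂ => 1 - (γ : ℂ) * z) (Metric.ball 0 1) := by fun_prop
  -- The coefficients of the equation pulled back by `ψ`. At $z=0$ this one still equals $B(r_0)$,
  -- so the characteristic exponents do not change.
  have hb : DifferentiableOn ℂ (fun z => (B (ψ z) - 2 * γ * z) / (1 - γ * z))
      (Metric.ball 0 1) :=
    DifferentiableOn.div ((hB.comp hψd hψU).sub (by fun_prop)) hlin
      fun z hz => hden z (by simpa using hz)
  have hc : DifferentiableOn ℂ (fun z => β * C (ψ z) / (1 - γ * z) ^ 3) (Metric.ball 0 1) :=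
    DifferentiableOn.div ((hC.comp hψd hψU).const_mul _) (hlin.pow 3)
      fun z hz => pow_ne_zero _ (hden z (by simpa using hz))
  obtain ⟨y, y', y'', hy0, hy⟩ := exists_frobenius_unitDisk hb hc (by
    intro k
    simpa [hψ0] using h0 k)
  set w : ℂ → ℂ := fun r => β + γ * (r - r₀) with hw
  refine ⟨fun r => y ((r - r₀) / w r), fun r => y' ((r - r₀) / w r) * (β / w r ^ 2),
    fun r => y'' ((r - r₀) / w r) * (β / w r ^ 2) * (β / w r ^ 2)
      + y' ((r - r₀) / w r) * (-(2 * γ * β) / w r ^ 3), by simp [hy0], fun r hr => ?_⟩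
  have hwpos : 0 < ‖w r‖ := (norm_nonneg _).trans_lt hr
  have hw0 : w r ≠ 0 := norm_pos_iff.1 hwpos
  have hZ : ‖(r - r₀) / w r‖ < 1 := by
    rw [norm_div, div_lt_one hwpos]; exact hr
  obtain ⟨h1, h2, h3⟩ := hy _ hZ
  have hwd : HasDerivAt w γ r :=
    ((((hasDerivAt_id r).sub_const (r₀ : ℂ)).const_mul (γ : ℂ)).const_add (β : ℂ)).congr_deriv
      (mul_one _)
  have hZd : HasDerivAt (fun r => (r - r₀) / w r) (β / w r ^ 2) r := by
    have := ((hasDerivAt_id r).sub_const (r₀ : ℂ)).div hwd hw0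
    refine this.congr_deriv ?_
    simp only [hw, id]
    ring
  have hβw : HasDerivAt (fun r => β / w r ^ 2) (-(2 * γ * β) / w r ^ 3) r := by
    have := (hasDerivAt_const r (β : ℂ)).div (hwd.pow 2) (pow_ne_zero 2 hw0)
    refine this.congr_deriv ?_
    simp only [Nat.cast_ofNat, Pi.pow_apply]
    field_simp
    ring
  refine ⟨h1.comp r hZd, (h2.comp r hZd).mul hβw, ?_⟩
  have e1 : (1 : ℂ) - γ * ((r - r₀) / w r) = β / w r := by
    have : w r = β + γ * (r - r₀) := rfl
    field_simp
    rw [this]; ring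
  have e2 : ψ ((r - r₀) / w r) = r := by
    simp only [hψ, e1]
    field_simp
    ring
  rw [e1, e2] at h3
  have h4 : (β : ℂ) ^ 2 / w r ^ 3 * ((r - r₀) / w r * y'' ((r - r₀) / w r) +
      (B r - 2 * γ * ((r - r₀) / w r)) / (β / w r) * y' ((r - r₀) / w r) +
      β * C r / (β / w r) ^ 3 * y ((r - r₀) / w r)) = 0 := by rw [h3, mul_zero]
  rw [← h4]
  beta_reduce
  generalize y ((r - r₀) / w r) = Y0
  generalize y' ((r - r₀) / w r) = Y1
  generalize y'' ((r - r₀) / w r) = Y2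
  field_simp
  ring

/-! ### Existence of the solutions normalised at the horizons. -/

theorem ofReal_abs_cpow_eq_exp {x : ℝ} (hx : x ≠ 0) (ρ : ℂ) :
    ((|x| : ℝ) : ℂ) ^ ρ = Complex.exp (ρ * (Real.log x : ℝ)) := by
  rw [Complex.cpow_def_of_ne_zero (by exact_mod_cast abs_ne_zero.2 hx),
    ← Complex.ofReal_log (abs_nonneg x), Real.log_abs, mul_comm]

theorem hasDerivAt_ofReal_abs_cpow {x : ℝ} (hx : x ≠ 0) (ρ : ℂ) :
    HasDerivAt (fun x : ℝ => ((|x| : ℝ) : ℂ) ^ ρ) (((|x| : ℝ) : ℂ) ^ ρ * (ρ / x)) x := by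
  have h := (((Real.hasDerivAt_log hx).ofReal_comp).const_mul ρ).cexp
  rw [ofReal_abs_cpow_eq_exp hx]
  refine (h.congr_of_eventuallyEq ?_).congr_deriv (by push_cast; rw [div_eq_mul_inv])
  filter_upwards [isOpen_ne.mem_nhds hx] with y hy
  exact ofReal_abs_cpow_eq_exp hy ρ

theorem contDiffAt_ofReal_abs_cpow {x : ℝ} (hx : x ≠ 0) (ρ : ℂ) {n : WithTop ℕ∞} :
    ContDiffAt ℝ n (fun x : ℝ => ((|x| : ℝ) : ℂ) ^ ρ) x := by
  have h : ContDiffAt ℝ n (fun x : ℝ => Complex.exp (ρ * (Real.log x : ℝ))) x := by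
    refine ContDiffAt.cexp (contDiffAt_const.mul ?_)
    exact Complex.ofRealCLM.contDiff.contDiffAt.comp x (Real.contDiffAt_log.2 hx)
  refine h.congr_of_eventuallyEq ?_
  filter_upwards [isOpen_ne.mem_nhds hx] with y hy
  exact ofReal_abs_cpow_eq_exp hy ρ

namespace RNAdS

/-- The quadratic factor of `l² Δ / ((r - r₋) (r - r₊))`. -/
def quad (p : RNAdS) (r : ℝ) : ℝ :=
  r ^ 2 + (p.rm + p.rp) * r + (p.l ^ 2 + p.rm ^ 2 + p.rm * p.rp + p.rp ^ 2)

/-- The extension of `quad` to the complex plane. -/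
def quadC (p : RNAdS) (r : ℂ) : ℂ :=
  r ^ 2 + (p.rm + p.rp) * r + (p.l ^ 2 + p.rm ^ 2 + p.rm * p.rp + p.rp ^ 2)

theorem ofReal_quad (p : RNAdS) (r : ℝ) : ((p.quad r : ℝ) : ℂ) = p.quadC r := by
  simp [quad, quadC]

theorem rp_pos (p : RNAdS) : 0 < p.rp := p.rm_pos.trans p.rm_lt_rp

theorem quad_pos (p : RNAdS) {r : ℝ} (hr : 0 ≤ r) : 0 < p.quad r := by
  have := p.rm_pos; have := p.rp_pos; have := p.l_pos
  unfold quad; positivity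

/-- The two remaining roots of $\Delta$ have negative real part, so the right half-plane contains no
singular points of $(*)$ besides $r_\pm$. -/
theorem quadC_ne_zero (p : RNAdS) {r : ℂ} (hr : 0 < r.re) : p.quadC r ≠ 0 := by
  intro h
  have h1 := p.rm_pos; have h2 := p.rp_pos; have h3 := p.l_pos
  have him := congrArg Complex.im h
  have hre := congrArg Complex.re h
  simp only [quadC, pow_two, Complex.add_re, Complex.mul_re, Complex.add_im, Complex.mul_im,
    Complex.ofReal_re, Complex.ofReal_im, Complex.zero_re, Complex.zero_im] at him hre
  have h4 : r.im * (2 * r.re + (p.rm + p.rp)) = 0 := by linarith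
  have h5 : r.im = 0 := by
    rcases mul_eq_zero.1 h4 with h | h
    · exact h
    · nlinarith
  rw [h5] at hre
  nlinarith [mul_pos h1 h2, mul_pos h3 h3, mul_pos hr h1, mul_pos hr h2, mul_pos h1 h1,
    mul_pos h2 h2, mul_pos hr hr]

theorem two_mul_M (p : RNAdS) :
    2 * p.M = (p.rm + p.rp) * (1 + (p.rm ^ 2 + p.rp ^ 2) / p.l ^ 2) := by
  have hl := p.l_pos.ne'
  have hd : p.rp - p.rm ≠ 0 := sub_ne_zero.2 p.rm_lt_rp.ne'
  refine mul_left_cancel₀ hd ?_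
  have h1 := p.root_rm
  have h2 := p.root_rp
  linear_combination h1 - h2

theorem Q_sq (p : RNAdS) :
    p.Q ^ 2 = p.rm * p.rp * (1 + (p.rm ^ 2 + p.rm * p.rp + p.rp ^ 2) / p.l ^ 2) := by
  linear_combination p.root_rm + p.rm * p.two_mul_M

theorem Δ_eq (p : RNAdS) (r : ℝ) :
    p.Δ r = (r - p.rm) * (r - p.rp) * p.quad r / p.l ^ 2 := by
  have hl := p.l_pos.ne'
  have h1 := p.two_mul_M
  have h2 := p.Q_sq
  unfold Δ quad
  rw [h1, h2]
  field_simp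
  ring

theorem two_mul_κp (p : RNAdS) :
    2 * p.κp = (p.rp - p.rm) * p.quad p.rp / (p.l ^ 2 * p.rp ^ 2) := by
  have hl := p.l_pos.ne'
  have hr := p.rp_pos.ne'
  have h1 := p.two_mul_M
  have h3 : 2 * p.κp = (2 * p.rp - 2 * p.M + 4 * p.rp ^ 3 / p.l ^ 2) / p.rp ^ 2 := by
    unfold κp; ring
  rw [h3, h1, quad]
  field_simp
  ring

theorem two_mul_κm (p : RNAdS) :
    2 * p.κm = (p.rp - p.rm) * p.quad p.rm / (p.l ^ 2 * p.rm ^ 2) := by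
  have hl := p.l_pos.ne'
  have hr := p.rm_pos.ne'
  have h1 := p.two_mul_M
  have h3 : 2 * p.κm = -((2 * p.rm - 2 * p.M + 4 * p.rm ^ 3 / p.l ^ 2) / p.rm ^ 2) := by
    unfold κm; ring
  rw [h3, h1, quad]
  field_simp
  ring

theorem κp_pos (p : RNAdS) : 0 < p.κp := by
  have h := p.two_mul_κp
  have h1 := p.l_pos; have h2 := p.rp_pos
  have h3 := p.quad_pos h2.le
  have h4 := sub_pos.2 p.rm_lt_rp
  have : 0 < 2 * p.κp := by rw [h]; positivity
  linarith

theorem κm_pos (p : RNAdS) : 0 < p.κm := by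
  have h := p.two_mul_κm
  have h1 := p.l_pos; have h2 := p.rm_pos
  have h3 := p.quad_pos h2.le
  have h4 := sub_pos.2 p.rm_lt_rp
  have : 0 < 2 * p.κm := by rw [h]; positivity
  linarith

theorem hasDerivAt_Δ (p : RNAdS) (r : ℝ) :
    HasDerivAt p.Δ (2 * r - 2 * p.M + 4 * r ^ 3 / p.l ^ 2) r := by
  have := ((((hasDerivAt_id r).pow 2).sub ((hasDerivAt_id r).const_mul (2 * p.M))).add
    (((hasDerivAt_id r).pow 4).div_const (p.l ^ 2))).add_const (p.Q ^ 2)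
  refine this.congr_deriv ?_
  simp only [id]
  norm_num

/-- With $\Delta=(r-r_0)B$, inserting $|r-r_0|^\rho Y$ into $(*)$ leaves a Frobenius equation for
$Y$ with exponent $0$. The hypothesis `hρ` is the indicial equation, and `hres` excludes resonance.
-/
theorem exists_horizon_solution (p : RNAdS) {r₀ r₁ β γ : ℝ}
    (hΔ : ∀ r, p.Δ r = (r - r₀) * ((r - r₁) * p.quad r / p.l ^ 2)) (hβ : 0 < β) (hγ : |γ| ≤ 1)
    {ω ρ : ℂ} (ℓ : ℕ) (hρ : (ρ * ((r₀ - r₁) * p.quadC r₀ / p.l ^ 2)) ^ 2 + ω ^ 2 * r₀ ^ 4 = 0)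
    (hres : ρ.im ≠ 0) (h1 : ∀ r ∈ mobiusDisk r₀ β γ, r ≠ r₁)
    (h2 : ∀ r ∈ mobiusDisk r₀ β γ, p.quadC r ≠ 0) :
    ∃ R Rt : ℝ → ℂ, AnalyticOnNhd ℝ Rt {r | (r : ℂ) ∈ mobiusDisk r₀ β γ} ∧ Rt r₀ = 1 ∧
      (∀ r, R r = ((|r - r₀| : ℝ) : ℂ) ^ ρ * Rt r) ∧
      ∀ s : Set ℝ, (∀ r ∈ s, (r : ℂ) ∈ mobiusDisk r₀ β γ ∧ r ≠ r₀ ∧ r ≠ 0) →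
        p.SolvesRadial ω ℓ R s := by
  have hl : (p.l : ℂ) ≠ 0 := by exact_mod_cast p.l_pos.ne'
  set U := mobiusDisk r₀ β γ with hU
  have hUo : IsOpen U := isOpen_mobiusDisk _ _ _
  have hr₀U : (r₀ : ℂ) ∈ U := by
    change ‖_‖ < ‖_‖
    simpa using hβ.ne'
  set B : ℂ → ℂ := fun r => (r - r₁) * p.quadC r / p.l ^ 2 with hB
  set B' : ℂ → ℂ := fun r => (p.quadC r + (r - r₁) * (2 * r + (p.rm + p.rp))) / p.l ^ 2 with hB'
  have hBne : ∀ r ∈ U, B r ≠ 0 := fun r hr =>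
    div_ne_zero (mul_ne_zero (sub_ne_zero.2 (h1 r hr)) (h2 r hr)) (pow_ne_zero _ hl)
  have hBd : ∀ r, HasDerivAt B (B' r) r := by
    intro r
    have hq : HasDerivAt p.quadC (2 * r + (p.rm + p.rp)) r := by
      have := (((hasDerivAt_id r).pow 2).add ((hasDerivAt_id r).const_mul
        ((p.rm : ℂ) + p.rp))).add_const ((p.l : ℂ) ^ 2 + p.rm ^ 2 + p.rm * p.rp + p.rp ^ 2)
      refine this.congr_deriv ?_
      simp
    have := (((hasDerivAt_id r).sub_const (r₁ : ℂ)).mul hq).div_const ((p.l : ℂ) ^ 2)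
    refine this.congr_deriv ?_
    simp only [hB', id, one_mul]
  have hBdiff : Differentiable ℂ B := fun r => (hBd r).differentiableAt
  have hB'diff : Differentiable ℂ B' := by
    have : Differentiable ℂ p.quadC := by unfold quadC; fun_prop
    simp only [hB']; fun_prop
  set F : ℂ → ℂ := fun r => (ρ * B r) ^ 2 + ω ^ 2 * r ^ 4 with hF
  have hF0 : F r₀ = 0 := hρ
  -- The indicial equation says that `F` vanishes at `r₀`; dividing by $r-r_0$ lowers the
  -- singularity of the zeroth-order coefficient to the order that Frobenius' theorem allows.
  set S : ℂ → ℂ := dslope F r₀ with hS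
  have hSd : DifferentiableOn ℂ S U :=
    (Complex.differentiableOn_dslope (hUo.mem_nhds hr₀U)).2 (by
      simp only [hF]; fun_prop)
  have hSF : ∀ r, (r - r₀) * S r = F r := by
    intro r
    have := sub_smul_dslope F (r₀ : ℂ) r
    rw [hF0, sub_zero] at this
    simpa using this
  set V : ℂ → ℂ := fun r => p.α / p.l ^ 2 * r ^ 2 - ℓ * (ℓ + 1) with hV
  obtain ⟨Y, Y', Y'', hY0, hY⟩ := exists_frobenius_mobiusDisk (r₀ := r₀) (β := β) (γ := γ) hβ hγ
    (B := fun r => 1 + 2 * ρ + (r - r₀) * B' r / B r)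
    (C := fun r => ρ * B' r / B r + S r / B r ^ 2 + V r / B r)
    ((differentiableOn_const _).add (DifferentiableOn.div (by fun_prop) hBdiff.differentiableOn
      hBne))
    (((DifferentiableOn.div (by fun_prop) hBdiff.differentiableOn hBne).add
      (hSd.div (by fun_prop) fun r hr => pow_ne_zero _ (hBne r hr))).add
      (DifferentiableOn.div (by simp only [hV]; fun_prop) hBdiff.differentiableOn hBne))
    -- Nonresonance: $k+1+2\rho$ has imaginary part $2\operatorname{Im}\rho\ne0$.
    (by
      intro k h
      have := congrArg Complex.im h
      simp at this
      exact hres this)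
  have hYan : AnalyticOnNhd ℂ Y U :=
    DifferentiableOn.analyticOnNhd (fun r hr => (hY r hr).1.differentiableAt.differentiableWithinAt)
      hUo
  have hRtan : AnalyticOnNhd ℝ (fun r : ℝ => Y r) {r | (r : ℂ) ∈ U} := fun r hr =>
    ((hYan r hr).restrictScalars (𝕜 := ℝ)).comp (Complex.ofRealCLM.analyticAt r)
  set E : ℝ → ℂ := fun r => ((|r - r₀| : ℝ) : ℂ) ^ ρ with hE
  have hEd : ∀ r, r ≠ r₀ → HasDerivAt E (E r * (ρ / ((r : ℂ) - r₀))) r := by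
    intro r hr
    have := (hasDerivAt_ofReal_abs_cpow (sub_ne_zero.2 hr) ρ).scomp r
      ((hasDerivAt_id r).sub_const r₀)
    refine this.congr_deriv ?_
    simp [hE]
  have hΔc : ∀ r : ℝ, ((p.Δ r : ℝ) : ℂ) = (r - r₀) * B r := by
    intro r
    rw [hΔ, hB]
    push_cast
    rw [ofReal_quad]
  have hopen : IsOpen {r : ℝ | (r : ℂ) ∈ U ∧ r ≠ r₀} :=
    (hUo.preimage Complex.continuous_ofReal).inter isOpen_ne
  have hRd : ∀ r : ℝ, (r : ℂ) ∈ U → r ≠ r₀ → HasDerivAt (fun r : ℝ => E r * Y r)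
      (E r * (Y' r + ρ * Y r / ((r : ℂ) - r₀))) r := by
    intro r hr hr0
    have := (hEd r hr0).mul (hY r hr).1.comp_ofReal
    refine this.congr_deriv ?_
    ring
  refine ⟨fun r => E r * Y r, fun r => Y r, hRtan, hY0, fun r => rfl, fun s hs => ⟨?_, ?_⟩⟩
  · intro r hr
    obtain ⟨hrU, hr0, -⟩ := hs r hr
    have h3 : ContDiffAt ℝ 2 E r :=
      (contDiffAt_ofReal_abs_cpow (sub_ne_zero.2 hr0) ρ).comp r
        (contDiffAt_id.sub contDiffAt_const)
    exact (h3.mul (hRtan r hrU).contDiffAt).contDiffWithinAt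
  · intro r hr
    obtain ⟨hrU, hr0, hrz⟩ := hs r hr
    have hx : (r : ℂ) - r₀ ≠ 0 := by exact_mod_cast sub_ne_zero.2 hr0
    have hev : (fun x : ℝ => (p.Δ x : ℂ) * deriv (fun r : ℝ => E r * Y r) x) =ᶠ[𝓝 r]
        fun x : ℝ => E x * (B x * (((x : ℂ) - r₀) * Y' x + ρ * Y x)) := by
      filter_upwards [hopen.mem_nhds ⟨hrU, hr0⟩] with x hx
      have hx0 : (x : ℂ) - r₀ ≠ 0 := by exact_mod_cast sub_ne_zero.2 hx.2
      rw [(hRd x hx.1 hx.2).deriv, hΔc]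
      field_simp
    obtain ⟨d1, d2, ode⟩ := hY r hrU
    have hder := (hEd r hr0).mul ((hBd r).comp_ofReal.mul
      (((((hasDerivAt_id (r : ℂ)).sub_const (r₀ : ℂ)).comp_ofReal).mul d2.comp_ofReal).add
        (d1.comp_ofReal.const_mul ρ)))
    rw [hev.deriv_eq]
    erw [hder.deriv]
    have hBr := hBne r hrU
    have hSr := hSF r
    have hrz' : (r : ℂ) ≠ 0 := by exact_mod_cast hrz
    push_cast
    rw [hΔc]
    simp only [id, one_mul, hF, hV, Pi.mul_apply, Pi.add_apply] at hSr ode ⊢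
    generalize B (r : ℂ) = b at *
    generalize B' (r : ℂ) = b' at *
    generalize E r = e at *
    generalize Y (r : ℂ) = y0 at *
    generalize Y' (r : ℂ) = y1 at *
    generalize Y'' (r : ℂ) = y2 at *
    generalize S (r : ℂ) = σ at *
    generalize hxx : (r : ℂ) - r₀ = x at *
    have ode' : x * y2 * b ^ 2 + ((1 + 2 * ρ) * b ^ 2 + x * b' * b) * y1 + (ρ * b' * b + σ
        + (p.α / p.l ^ 2 * (r : ℂ) ^ 2 - ℓ * (ℓ + 1)) * b) * y0 = 0 := by
      have h3 := congrArg (fun t => t * b ^ 2) ode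
      simp only [zero_mul] at h3
      rw [← h3]
      field_simp
    have hfin : ((r : ℂ) ^ 4)⁻¹ * (e * x * (x * y2 * b ^ 2 + ((1 + 2 * ρ) * b ^ 2 + x * b' * b) * y1
        + (ρ * b' * b + σ + (p.α / p.l ^ 2 * (r : ℂ) ^ 2 - ℓ * (ℓ + 1)) * b) * y0)
        - e * y0 * (x * σ - ((ρ * b) ^ 2 + ω ^ 2 * (r : ℂ) ^ 4))) = 0 := by
      rw [ode', hSr, sub_self, mul_zero, mul_zero, sub_self, mul_zero]
    rw [← hfin]
    field_simp
    ring

/-- The Möbius image of the disk is here the half-plane $\operatorname{Re}r>r_-$, the points closer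
to $r_+$ than to its reflection $2r_--r_+$. A single series thus covers all of $(r_-,\infty)$. -/
theorem exists_isRHR (p : RNAdS) {ω : ℂ} (hω : ω.re ≠ 0) (ℓ : ℕ) : ∃ R, p.IsRHR ω ℓ R := by
  have hd : 0 < p.rp - p.rm := sub_pos.2 p.rm_lt_rp
  have hmem : ∀ r : ℂ, r ∈ mobiusDisk p.rp (2 * (p.rp - p.rm)) 1 ↔ p.rm < r.re := by
    intro r
    change ‖_‖ < ‖_‖ ↔ _
    rw [← sq_lt_sq₀ (norm_nonneg _) (norm_nonneg _), ← Complex.normSq_eq_norm_sq,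
      ← Complex.normSq_eq_norm_sq, Complex.normSq_apply, Complex.normSq_apply]
    simp
    constructor <;> intro h <;> nlinarith
  have hκ := p.κp_pos
  have h2κ := p.two_mul_κp
  have hr := p.rp_pos
  have hl := p.l_pos
  obtain ⟨R, Rt, han, h0, hR, hs⟩ := p.exists_horizon_solution (r₀ := p.rp) (r₁ := p.rm)
    (β := 2 * (p.rp - p.rm)) (γ := 1) (fun r => by rw [p.Δ_eq]; ring) (by positivity) (by simp)
    (ω := ω) (ρ := -(Complex.I * ω / (2 * (p.κp : ℂ)))) ℓ
    (by
      have h4 : ((p.rp : ℂ) - p.rm) * p.quadC p.rp / p.l ^ 2 = 2 * p.κp * p.rp ^ 2 := by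
        rw [← ofReal_quad]
        norm_cast
        rw [h2κ]
        field_simp
      rw [h4]
      have hκ' : (p.κp : ℂ) ≠ 0 := by exact_mod_cast hκ.ne'
      field_simp
      linear_combination (ω ^ 2 * p.rp ^ 4) * Complex.I_sq)
    (by
      have : Complex.I * ω / (2 * (p.κp : ℂ)) = Complex.I * ω / ((2 * p.κp : ℝ) : ℂ) := by
        push_cast; rfl
      rw [this, Complex.neg_im, Complex.div_ofReal_im]
      simpa using ⟨hω, hκ.ne'⟩)
    (fun r hr h => by
      rw [hmem, h] at hr
      simp at hr)
    (fun r hr => p.quadC_ne_zero (p.rm_pos.trans ((hmem r).1 hr)))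
  refine ⟨R, hs _ fun r hr => ⟨(hmem _).2 hr.1, hr.2, (p.rm_pos.trans hr.1).ne'⟩, Rt, ?_, h0,
    fun r _ => hR r⟩
  intro r hr
  exact han r ((hmem _).2 hr)

/-- The Möbius image is the disk with diameter $(0,r_+)$, seen from $r_-$: the parameters are those
for which the boundary circle passes through the singular points $0$ and $r_+$. -/
theorem exists_cauchyHorizon_solution (p : RNAdS) {ω ρ : ℂ} (ℓ : ℕ)
    (hρ : (ρ * (2 * p.κm)) ^ 2 = -ω ^ 2) (hres : ρ.im ≠ 0) :
    ∃ R Rt : ℝ → ℂ, AnalyticOnNhd ℝ Rt (Set.Ico p.rm p.rp) ∧ Rt p.rm = 1 ∧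
      (∀ r ∈ Set.Ioo p.rm p.rp, R r = ((r - p.rm : ℝ) : ℂ) ^ ρ * Rt r) ∧
      p.SolvesRadial ω ℓ R (Set.Ioo p.rm p.rp) := by
  have hd : 0 < p.rp - p.rm := sub_pos.2 p.rm_lt_rp
  have hκ := p.κm_pos
  have h2κ := p.two_mul_κm
  have hr := p.rm_pos
  have hrp := p.rp_pos
  have hl := p.l_pos
  set d := p.rp - p.rm with hdef
  have hmem : ∀ r : ℂ, r ∈ mobiusDisk p.rm (2 * d * p.rm / (d + p.rm)) ((d - p.rm) / (d + p.rm)) ↔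
      r.re ^ 2 + r.im ^ 2 < p.rp * r.re := by
    intro r
    change ‖_‖ < ‖_‖ ↔ _
    have e : ((2 * d * p.rm / (d + p.rm) : ℝ) : ℂ) + (((d - p.rm) / (d + p.rm) : ℝ) : ℂ)
        * (r - p.rm) = (2 * d * p.rm + (d - p.rm) * (r - p.rm)) / ((d + p.rm : ℝ) : ℂ) := by
      push_cast; ring
    have hdr : 0 < d + p.rm := by positivity
    rw [e, norm_div, Complex.norm_real, Real.norm_of_nonneg hdr.le, lt_div_iff₀ hdr,
      ← sq_lt_sq₀ (by positivity) (norm_nonneg _), mul_pow, ← Complex.normSq_eq_norm_sq,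
      ← Complex.normSq_eq_norm_sq, Complex.normSq_apply, Complex.normSq_apply]
    simp
    have hrp' : p.rp = d + p.rm := by rw [hdef]; ring
    rw [hrp']
    have key : (2 * d * p.rm + (d - p.rm) * (r.re - p.rm)) * (2 * d * p.rm + (d - p.rm) *
        (r.re - p.rm)) + (d - p.rm) * r.im * ((d - p.rm) * r.im) -
        ((r.re - p.rm) * (r.re - p.rm) + r.im * r.im) * (d + p.rm) ^ 2
        = 4 * d * p.rm * ((d + p.rm) * r.re - (r.re ^ 2 + r.im ^ 2)) := by ring
    have h4 : 0 < 4 * d * p.rm := by positivity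
    constructor <;> intro h
    · by_contra hn
      nlinarith [mul_nonneg h4.le (sub_nonneg.2 (not_lt.1 hn))]
    · nlinarith [mul_pos h4 (sub_pos.2 h)]
  obtain ⟨R, Rt, han, h0, hR, hs⟩ := p.exists_horizon_solution (r₀ := p.rm) (r₁ := p.rp)
    (β := 2 * d * p.rm / (d + p.rm)) (γ := (d - p.rm) / (d + p.rm))
    (fun r => by rw [p.Δ_eq]; ring) (by positivity)
    (by
      rw [abs_div, abs_of_pos (by positivity : 0 < d + p.rm), div_le_one (by positivity), abs_le]
      constructor <;> linarith)
    (ω := ω) (ρ := ρ) ℓ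
    (by
      have h4 : ((p.rm : ℂ) - p.rp) * p.quadC p.rm / p.l ^ 2 = -(2 * p.κm * p.rm ^ 2) := by
        rw [← ofReal_quad]
        norm_cast
        rw [h2κ]
        field_simp
        rw [hdef]; ring
      rw [h4]
      linear_combination (p.rm ^ 4 : ℂ) * hρ)
    hres
    (fun r hr h => by
      rw [hmem, h] at hr
      simp [pow_two] at hr)
    (fun r hr => p.quadC_ne_zero (by
      have := (hmem r).1 hr
      by_contra hn
      nlinarith [sq_nonneg r.re, sq_nonneg r.im]))
  have hreal : ∀ r ∈ Set.Ico p.rm p.rp, (r : ℂ) ∈ mobiusDisk p.rm (2 * d * p.rm / (d + p.rm))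
      ((d - p.rm) / (d + p.rm)) := by
    intro r hr
    rw [hmem]
    simp only [Complex.ofReal_re, Complex.ofReal_im]
    nlinarith [hr.1, hr.2]
  refine ⟨R, Rt, fun r hr => han r (hreal r hr), h0, fun r hr => ?_, hs _ fun r hr =>
    ⟨hreal r ⟨hr.1.le, hr.2⟩, hr.1.ne', (p.rm_pos.trans hr.1).ne'⟩⟩
  rw [hR, abs_of_pos (sub_pos.2 hr.1)]

theorem exists_isRCHL (p : RNAdS) {ω : ℂ} (hω : ω.re ≠ 0) (ℓ : ℕ) : ∃ R, p.IsRCHL ω ℓ R := by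
  have hκ : (p.κm : ℂ) ≠ 0 := by exact_mod_cast p.κm_pos.ne'
  obtain ⟨R, Rt, h1, h2, h3, h4⟩ := p.exists_cauchyHorizon_solution (ω := ω)
    (ρ := Complex.I * ω / (2 * (p.κm : ℂ))) ℓ
    (by field_simp; linear_combination ω ^ 2 * Complex.I_sq)
    (by
      have : Complex.I * ω / (2 * (p.κm : ℂ)) = Complex.I * ω / ((2 * p.κm : ℝ) : ℂ) := by
        push_cast; rfl
      rw [this, Complex.div_ofReal_im]
      simpa using ⟨hω, p.κm_pos.ne'⟩)
  exact ⟨R, h4, Rt, h1, h2, h3⟩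

theorem exists_isRCHR (p : RNAdS) {ω : ℂ} (hω : ω.re ≠ 0) (ℓ : ℕ) : ∃ R, p.IsRCHR ω ℓ R := by
  have hκ : (p.κm : ℂ) ≠ 0 := by exact_mod_cast p.κm_pos.ne'
  obtain ⟨R, Rt, h1, h2, h3, h4⟩ := p.exists_cauchyHorizon_solution (ω := ω)
    (ρ := -(Complex.I * ω / (2 * (p.κm : ℂ)))) ℓ
    (by field_simp; linear_combination ω ^ 2 * Complex.I_sq)
    (by
      have : Complex.I * ω / (2 * (p.κm : ℂ)) = Complex.I * ω / ((2 * p.κm : ℝ) : ℂ) := by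
        push_cast; rfl
      rw [this, Complex.neg_im, Complex.div_ofReal_im]
      simpa using ⟨hω, p.κm_pos.ne'⟩)
  exact ⟨R, h4, Rt, h1, h2, h3⟩

end RNAdS

/-! ### Almost conservation of the flux near a horizon. -/

theorem le_limit_of_deriv_nonpos {f f' : ℝ → ℝ} {X l : ℝ}
    (hf : ∀ x ∈ Set.Ioc 0 X, HasDerivAt f (f' x) x) (h : ∀ x ∈ Set.Ioc 0 X, f' x ≤ 0)
    (hl : Filter.Tendsto f (𝓝[>] 0) (𝓝 l)) {x : ℝ} (hx : x ∈ Set.Ioc 0 X) : f x ≤ l := by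
  have hanti : AntitoneOn f (Set.Ioc 0 X) := by
    refine antitoneOn_of_deriv_nonpos (convex_Ioc 0 X)
      (fun y hy => (hf y hy).continuousAt.continuousWithinAt)
      (fun y hy => (hf y (interior_subset hy)).differentiableAt.differentiableWithinAt)
      fun y hy => ?_
    rw [(hf y (interior_subset hy)).deriv]
    exact h y (interior_subset hy)
  refine ge_of_tendsto hl ?_
  filter_upwards [Ioo_mem_nhdsGT hx.1] with y hy
  exact hanti ⟨hy.1, hy.2.le.trans hx.2⟩ hx hy.2.le

theorem HasDerivAt.re_comp {f : ℝ → ℂ} {f' : ℂ} {x : ℝ} (h : HasDerivAt f f' x) :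
    HasDerivAt (fun x => (f x).re) f'.re x :=
  (Complex.reCLM.hasFDerivAt.comp_hasDerivAt x h)

theorem HasDerivAt.im_comp {f : ℝ → ℂ} {f' : ℂ} {x : ℝ} (h : HasDerivAt f f' x) :
    HasDerivAt (fun x => (f x).im) f'.im x :=
  (Complex.imCLM.hasFDerivAt.comp_hasDerivAt x h)

/-- Almost conservation of the flux between a horizon (`x = 0`) and the sphere `x = X`, for a
solution that is regular at the horizon after its oscillating factor has been split off. -/
theorem flux_estimate {X K Λ m₀ : ℝ} {ω v₀ : ℂ} {μ A μ' A' : ℝ → ℝ} {v z : ℝ → ℂ} (hX : 0 < X)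
    (hK : 0 ≤ K) (hm₀ : 0 < m₀) (him : ω.im ≤ 0)
    (hv : ∀ x ∈ Set.Ioc 0 X, HasDerivAt v (z x / μ x) x)
    (hz : ∀ x ∈ Set.Ioc 0 X,
      HasDerivAt z (2 * Complex.I * ω * z x / μ x - A x * v x) x)
    (hμ : ∀ x ∈ Set.Ioc 0 X, HasDerivAt μ (μ' x) x)
    (hA : ∀ x ∈ Set.Ioc 0 X, HasDerivAt A (A' x) x)
    (hμx : ∀ x ∈ Set.Ioc 0 X, m₀ * x ≤ μ x) (hA0 : ∀ x ∈ Set.Ioc 0 X, 0 < A x)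
    (hAΛ : ∀ x ∈ Set.Ioc 0 X, A x ≤ Λ)
    (hgrowth : ∀ x ∈ Set.Ioc 0 X,
      -4 * ω.im * A x - (μ' x * A x + μ x * A' x) ≤ K * (μ x * A x))
    (hv0 : Filter.Tendsto v (𝓝[>] 0) (𝓝 v₀)) (hz0 : Filter.Tendsto z (𝓝[>] 0) (𝓝 0))
    (hz0' : Filter.Tendsto (fun x => Complex.normSq (z x) / (μ x * A x)) (𝓝[>] 0) (𝓝 0)) :
    |((starRingEnd ℂ (v X)) * z X).im - ω.re * Complex.normSq (v X) + ω.re * Complex.normSq v₀|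
      ≤ 4 * -ω.im * (Real.exp (K * X) * Complex.normSq v₀ * Real.sqrt (Λ / m₀)) * Real.sqrt X := by
  have hμ0 : ∀ x ∈ Set.Ioc 0 X, 0 < μ x := fun x hx => (mul_pos hm₀ hx.1).trans_le (hμx x hx)
  have hΛ : 0 < Λ := (hA0 X ⟨hX, le_rfl⟩).trans_le (hAΛ X ⟨hX, le_rfl⟩)
  have hcont : Filter.Tendsto (fun x => Complex.normSq (v x)) (𝓝[>] 0) (𝓝 (Complex.normSq v₀)) :=
    (Complex.continuous_normSq.tendsto _).comp hv0
  set N := Complex.normSq v₀ with hN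
  have hN0 : 0 ≤ N := Complex.normSq_nonneg _
  have zre : ∀ x, (2 * Complex.I * ω * z x / μ x - A x * v x).re
      = -2 * (ω.re * (z x).im + ω.im * (z x).re) / μ x - A x * (v x).re := by
    intro x
    simp only [Complex.sub_re, Complex.div_ofReal_re, Complex.mul_re, Complex.mul_im,
      Complex.I_re, Complex.I_im, Complex.ofReal_re, Complex.ofReal_im, Complex.re_ofNat,
      Complex.im_ofNat]
    ring
  have zim : ∀ x, (2 * Complex.I * ω * z x / μ x - A x * v x).im
      = 2 * (ω.re * (z x).re - ω.im * (z x).im) / μ x - A x * (v x).im := by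
    intro x
    simp only [Complex.sub_im, Complex.div_ofReal_im, Complex.mul_re, Complex.mul_im,
      Complex.I_re, Complex.I_im, Complex.ofReal_re, Complex.ofReal_im, Complex.re_ofNat,
      Complex.im_ofNat]
    ring
  have va : ∀ x ∈ Set.Ioc 0 X, HasDerivAt (fun x => (v x).re) ((z x).re / μ x) x := by
    intro x hx
    simpa only [Complex.div_ofReal_re] using (hv x hx).re_comp
  have vb : ∀ x ∈ Set.Ioc 0 X, HasDerivAt (fun x => (v x).im) ((z x).im / μ x) x := by
    intro x hx
    simpa only [Complex.div_ofReal_im] using (hv x hx).im_comp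
  have zc : ∀ x ∈ Set.Ioc 0 X, HasDerivAt (fun x => (z x).re) _ x := fun x hx =>
    ((hz x hx).re_comp).congr_deriv (zre x)
  have zd : ∀ x ∈ Set.Ioc 0 X, HasDerivAt (fun x => (z x).im) _ x := fun x hx =>
    ((hz x hx).im_comp).congr_deriv (zim x)
  -- The weight $1/(\mu A)$ makes the cross terms $\operatorname{Re}(\bar v z)/\mu$ cancel in the
  -- derivative, so only the logarithmic growth controlled by `hgrowth` is left.
  set G : ℝ → ℝ := fun x => ((z x).re ^ 2 + (z x).im ^ 2) / (μ x * A x)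
    + ((v x).re ^ 2 + (v x).im ^ 2) with hG
  have hGlim : Filter.Tendsto G (𝓝[>] 0) (𝓝 N) := by
    have := hz0'.add hcont
    rw [zero_add] at this
    refine this.congr fun x => ?_
    rw [hG, Complex.normSq_apply, Complex.normSq_apply]
    simp only [pow_two]
  have hGd : ∀ x ∈ Set.Ioc 0 X, HasDerivAt G
      ((-4 * ω.im * A x - (μ' x * A x + μ x * A' x)) / (μ x * A x) *
        (((z x).re ^ 2 + (z x).im ^ 2) / (μ x * A x))) x := by
    intro x hx
    have h1 := (hμ0 x hx).ne'
    have h2 := (hA0 x hx).ne'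
    have := ((((zc x hx).pow 2).add ((zd x hx).pow 2)).div ((hμ x hx).mul (hA x hx))
      (mul_ne_zero h1 h2)).add (((va x hx).pow 2).add ((vb x hx).pow 2))
    refine this.congr_deriv ?_
    simp only [Pi.add_apply, Pi.mul_apply, Pi.pow_apply]
    field_simp
    ring
  have hGle : ∀ x ∈ Set.Ioc 0 X, G x ≤ Real.exp (K * X) * N := by
    intro x hx
    have hexp : ∀ x : ℝ, HasDerivAt (fun x => Real.exp (-(K * x))) (Real.exp (-(K * x)) * -K) x := by
      intro x
      have := ((hasDerivAt_id x).const_mul K).neg.exp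
      simpa using this
    have h1 := le_limit_of_deriv_nonpos (X := X) (l := N)
      (f := fun x => Real.exp (-(K * x)) * G x)
      (fun x hx => (hexp x).mul (hGd x hx)) (fun x hx => by
        have e0 := Real.exp_pos (-(K * x))
        have h1 := hμ0 x hx
        have h2 := hA0 x hx
        have h3 : (-4 * ω.im * A x - (μ' x * A x + μ x * A' x)) / (μ x * A x) ≤ K := by
          rw [div_le_iff₀ (mul_pos h1 h2)]
          exact hgrowth x hx
        have h4 : 0 ≤ ((z x).re ^ 2 + (z x).im ^ 2) / (μ x * A x) := by positivity
        have h5 : ((z x).re ^ 2 + (z x).im ^ 2) / (μ x * A x) ≤ G x := by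
          simp only [hG]
          nlinarith [sq_nonneg (v x).re, sq_nonneg (v x).im]
        have h6 := mul_le_mul_of_nonneg_right h3 h4
        have h7 := mul_le_mul_of_nonneg_left h5 hK
        nlinarith [mul_le_mul_of_nonneg_left (h6.trans h7) e0.le])
      (by
        have h8 : Filter.Tendsto (fun x => Real.exp (-(K * x))) (𝓝[>] 0) (𝓝 1) := by
          have := (hexp 0).continuousAt.tendsto.mono_left
            (nhdsWithin_le_nhds (s := Set.Ioi (0 : ℝ)))
          simpa using this
        simpa using h8.mul hGlim) hx
    have h2 : G x = Real.exp (K * x) * (Real.exp (-(K * x)) * G x) := by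
      rw [← mul_assoc, ← Real.exp_add]; simp
    rw [h2]
    exact mul_le_mul (Real.exp_le_exp.2 (mul_le_mul_of_nonneg_left hx.2 hK)) h1
      (mul_nonneg (Real.exp_pos _).le (by
        have h1 := hμ0 x hx
        have h2 := hA0 x hx
        simp only [hG]; positivity)) (Real.exp_pos _).le
  set Γ := Real.exp (K * X) * N with hΓ
  have hΓ0 : 0 ≤ Γ := mul_nonneg (Real.exp_pos _).le hN0
  -- When `v` and `z` come from a wave $U$ by splitting off $e^{-i\omega S}$, this is $|e^{i\omega
  -- S}|^2$ times the flux of $U$; its derivative carries the factor $\operatorname{Im}\omega$.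
  set j : ℝ → ℝ := fun x => (v x).re * (z x).im - (v x).im * (z x).re
    - ω.re * ((v x).re ^ 2 + (v x).im ^ 2) with hj
  have hjd : ∀ x ∈ Set.Ioc 0 X, HasDerivAt j
      (2 * -ω.im * ((v x).re * (z x).im - (v x).im * (z x).re) / μ x) x := by
    intro x hx
    have h1 := (hμ0 x hx).ne'
    have := (((va x hx).mul (zd x hx)).sub ((vb x hx).mul (zc x hx))).sub
      ((((va x hx).pow 2).add ((vb x hx).pow 2)).const_mul ω.re)
    refine this.congr_deriv ?_
    field_simp
    ring
  set c := 2 * -ω.im * (Γ * Real.sqrt (Λ / m₀)) with hc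
  -- The energy bound gives $|\operatorname{Im}(\bar v z)|\le\Gamma\sqrt{\mu A}$; since $\mu\ge
  -- m_0x$, dividing by $\mu$ leaves the integrable singularity $x^{-1/2}$. This is the source of
  -- the factor $\sqrt X$.
  have hbound : ∀ x ∈ Set.Ioc 0 X,
      |2 * -ω.im * ((v x).re * (z x).im - (v x).im * (z x).re) / μ x| ≤ c / Real.sqrt x := by
    intro x hx
    have h1 := hμ0 x hx
    have h2 := hA0 x hx
    have h3 := hGle x hx
    have hsx : 0 < Real.sqrt x := Real.sqrt_pos.2 hx.1
    have h4 : (z x).re ^ 2 + (z x).im ^ 2 ≤ Γ * (μ x * A x) := by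
      rw [← div_le_iff₀ (mul_pos h1 h2)]
      refine le_trans ?_ h3
      simp only [hG]
      nlinarith [sq_nonneg (v x).re, sq_nonneg (v x).im]
    have h5 : (v x).re ^ 2 + (v x).im ^ 2 ≤ Γ := by
      refine le_trans ?_ h3
      simp only [hG]
      have : 0 ≤ ((z x).re ^ 2 + (z x).im ^ 2) / (μ x * A x) := by positivity
      linarith
    have h6 : |(v x).re * (z x).im - (v x).im * (z x).re| ≤ Γ * Real.sqrt (μ x * A x) := by
      refine abs_le_of_sq_le_sq ?_ (by positivity)
      rw [mul_pow, Real.sq_sqrt (by positivity)]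
      calc _ ≤ ((v x).re ^ 2 + (v x).im ^ 2) * ((z x).re ^ 2 + (z x).im ^ 2) := by
            nlinarith [sq_nonneg ((v x).re * (z x).re + (v x).im * (z x).im)]
        _ ≤ Γ * (Γ * (μ x * A x)) := by gcongr
        _ = _ := by ring
    have h7 : Real.sqrt (μ x * A x) / μ x ≤ Real.sqrt (Λ / m₀) / Real.sqrt x := by
      have e : Real.sqrt (μ x * A x) / μ x = Real.sqrt (A x / μ x) := by
        rw [mul_comm, Real.sqrt_mul h2.le, Real.sqrt_div h2.le, mul_div_assoc,
          Real.sqrt_div_self, ← div_eq_mul_inv]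
      rw [e, ← Real.sqrt_div (by positivity)]
      refine Real.sqrt_le_sqrt ?_
      rw [div_div]
      have := hμx x hx
      have := hAΛ x hx
      have := mul_pos hm₀ hx.1
      gcongr
    rw [abs_div, abs_of_pos h1, abs_mul, abs_of_nonneg (by linarith : 0 ≤ 2 * -ω.im)]
    calc _ ≤ 2 * -ω.im * (Γ * Real.sqrt (μ x * A x)) / μ x := by
          have : 0 ≤ 2 * -ω.im := by linarith
          gcongr
      _ = 2 * -ω.im * Γ * (Real.sqrt (μ x * A x) / μ x) := by ring
      _ ≤ 2 * -ω.im * Γ * (Real.sqrt (Λ / m₀) / Real.sqrt x) := by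
          have : 0 ≤ 2 * -ω.im := by linarith
          gcongr
      _ = _ := by rw [hc]; ring
  have hjlim : Filter.Tendsto j (𝓝[>] 0) (𝓝 (-(ω.re * N))) := by
    have h1 : Filter.Tendsto (fun x => ((starRingEnd ℂ (v x)) * z x).im) (𝓝[>] 0) (𝓝 0) := by
      have h2 := ((Complex.continuous_conj.tendsto v₀).comp hv0).mul hz0
      rw [mul_zero] at h2
      exact (Complex.continuous_im.tendsto _).comp h2
    have := h1.sub (hcont.const_mul ω.re)
    rw [zero_sub] at this
    refine this.congr fun x => ?_
    simp only [hj, Complex.mul_im, Complex.conj_re, Complex.conj_im, Complex.normSq_apply]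
    ring
  have hsq : ∀ x ∈ Set.Ioc 0 X, HasDerivAt (fun x => 2 * c * Real.sqrt x) (c / Real.sqrt x) x := by
    intro x hx
    have := (Real.hasDerivAt_sqrt hx.1.ne').const_mul (2 * c)
    refine this.congr_deriv ?_
    field_simp
  have hsqlim : Filter.Tendsto (fun x => 2 * c * Real.sqrt x) (𝓝[>] 0) (𝓝 0) := by
    have : Filter.Tendsto (fun x => 2 * c * Real.sqrt x) (𝓝 0) (𝓝 (2 * c * Real.sqrt 0)) :=
      (Real.continuous_sqrt.tendsto 0).const_mul _
    rw [Real.sqrt_zero, mul_zero] at this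
    exact this.mono_left nhdsWithin_le_nhds
  have hXX : X ∈ Set.Ioc 0 X := ⟨hX, le_rfl⟩
  have up := le_limit_of_deriv_nonpos (f := fun x => j x - 2 * c * Real.sqrt x)
    (fun x hx => (hjd x hx).sub (hsq x hx))
    (fun x hx => by linarith [(abs_le.1 (hbound x hx)).2]) (hjlim.sub hsqlim) hXX
  have lo := le_limit_of_deriv_nonpos (f := fun x => -(j x) - 2 * c * Real.sqrt x)
    (fun x hx => (hjd x hx).neg.sub (hsq x hx))
    (fun x hx => by linarith [(abs_le.1 (hbound x hx)).1]) (hjlim.neg.sub hsqlim) hXX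
  have e : ((starRingEnd ℂ (v X)) * z X).im - ω.re * Complex.normSq (v X) = j X := by
    simp only [hj, Complex.mul_im, Complex.conj_re, Complex.conj_im, Complex.normSq_apply]
    ring
  rw [e]
  have e2 : 4 * -ω.im * (Γ * Real.sqrt (Λ / m₀)) * Real.sqrt X = 2 * c * Real.sqrt X := by
    rw [hc]; ring
  rw [e2, abs_le]
  constructor <;> linarith

/-- Supplies the hypotheses of `flux_estimate` with `K` independent of `lam`. For $A=\lambda q+a$
and large $\lambda$, the term $\lambda q$ dominates $a$, so the relative derivatives of $m$ and $A$
are bounded. The term $-mA$ in $-(xmA)'$, which does not vanish at the horizon, absorbs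
$4\varepsilon A$; hence the condition $4\varepsilon\le m_0$. -/
theorem exists_uniform_horizon_constants {V : Set ℝ} (hV : IsOpen V) {X : ℝ} (hX : 0 < X)
    (hXV : Set.Icc 0 X ⊆ V) {m q a : ℝ → ℝ} (hm : ContDiffOn ℝ 1 m V) (hq : ContDiffOn ℝ 1 q V)
    (ha : ContDiffOn ℝ 1 a V) (hm0 : ∀ x ∈ Set.Icc 0 X, 0 < m x)
    (hq0 : ∀ x ∈ Set.Icc 0 X, 0 < q x) :
    ∃ K m₀ Λ lam₀ : ℝ, 0 ≤ K ∧ 0 < m₀ ∧ 0 < Λ ∧ 1 ≤ lam₀ ∧ ∀ lam, lam₀ ≤ lam →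
      ∀ x ∈ Set.Icc 0 X, m₀ ≤ m x ∧ 0 < lam * q x + a x ∧ lam * q x + a x ≤ Λ * lam ∧
        ∀ ε, 4 * ε ≤ m₀ → 4 * ε * (lam * q x + a x) - ((m x + x * deriv m x) * (lam * q x + a x)
          + x * m x * (lam * deriv q x + deriv a x)) ≤ K * (x * m x * (lam * q x + a x)) := by
  have hcomp : IsCompact (Set.Icc 0 X) := isCompact_Icc
  have hne : (Set.Icc 0 X).Nonempty := ⟨0, le_rfl, hX.le⟩
  have hdc : ∀ {f : ℝ → ℝ}, ContDiffOn ℝ 1 f V → ContinuousOn (deriv f) (Set.Icc 0 X) :=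
    fun hf => (hf.continuousOn_deriv_of_isOpen hV le_rfl).mono hXV
  obtain ⟨xm, hxm, hmin⟩ := hcomp.exists_isMinOn hne (hm.continuousOn.mono hXV)
  obtain ⟨xq, hxq, hqin⟩ := hcomp.exists_isMinOn hne (hq.continuousOn.mono hXV)
  obtain ⟨C1, hC1⟩ := hcomp.exists_bound_of_continuousOn (hdc hm)
  obtain ⟨C2, hC2⟩ := hcomp.exists_bound_of_continuousOn (hdc hq)
  obtain ⟨C3, hC3⟩ := hcomp.exists_bound_of_continuousOn (hdc ha)
  obtain ⟨C4, hC4⟩ := hcomp.exists_bound_of_continuousOn (hq.continuousOn.mono hXV)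
  obtain ⟨C5, hC5⟩ := hcomp.exists_bound_of_continuousOn (ha.continuousOn.mono hXV)
  have n1 := (norm_nonneg _).trans (hC1 0 ⟨le_rfl, hX.le⟩)
  have n2 := (norm_nonneg _).trans (hC2 0 ⟨le_rfl, hX.le⟩)
  have n3 := (norm_nonneg _).trans (hC3 0 ⟨le_rfl, hX.le⟩)
  have n4 := (norm_nonneg _).trans (hC4 0 ⟨le_rfl, hX.le⟩)
  have n5 := (norm_nonneg _).trans (hC5 0 ⟨le_rfl, hX.le⟩)
  have hM := hm0 _ hxm
  have hQ := hq0 _ hxq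
  set m₀ := m xm
  set q₀ := q xq
  refine ⟨C1 / m₀ + 2 * (C2 + C3) / q₀, m₀, C4 + C5 + 1, 1 + 2 * C5 / q₀, by positivity, hM,
    by positivity, by linarith [div_nonneg (mul_nonneg zero_le_two n5) hQ.le], ?_⟩
  intro lam hlam x hx
  have hl1 : 1 ≤ lam := by linarith [div_nonneg (mul_nonneg zero_le_two n5) hQ.le]
  have hmx : m₀ ≤ m x := hmin hx
  have hqx : q₀ ≤ q x := hqin hx
  have d1 := abs_le.1 (hC1 x hx)
  have d2 := abs_le.1 (hC2 x hx)
  have d3 := abs_le.1 (hC3 x hx)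
  have d4 := abs_le.1 (hC4 x hx)
  have d5 := abs_le.1 (hC5 x hx)
  have h5 : 2 * C5 ≤ lam * q₀ := by
    have : 2 * C5 / q₀ ≤ lam := by linarith
    rwa [div_le_iff₀ hQ] at this
  have hAlow : lam * q₀ / 2 ≤ lam * q x + a x := by
    nlinarith [mul_le_mul_of_nonneg_left hqx (by linarith : 0 ≤ lam)]
  have hA0 : 0 < lam * q x + a x := (by positivity : 0 < lam * q₀ / 2).trans_le hAlow
  refine ⟨hmx, hA0, ?_, fun ε hε => ?_⟩
  · nlinarith [mul_le_mul_of_nonneg_left d4.2 (by linarith : 0 ≤ lam)]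
  · set A := lam * q x + a x
    have hmx0 := hm0 x hx
    have t1 : 4 * ε * A ≤ m x * A := mul_le_mul_of_nonneg_right (hε.trans hmx) hA0.le
    have t2 : -deriv m x ≤ C1 / m₀ * m x := by
      have : C1 ≤ C1 / m₀ * m x := by
        calc C1 = C1 / m₀ * m₀ := by field_simp
          _ ≤ _ := by gcongr
      linarith
    have t3 : -(lam * deriv q x + deriv a x) ≤ 2 * (C2 + C3) / q₀ * A := by
      have h6 : -(lam * deriv q x + deriv a x) ≤ lam * (C2 + C3) := by
        nlinarith [mul_le_mul_of_nonneg_left d2.1 (by linarith : 0 ≤ lam)]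
      calc _ ≤ lam * (C2 + C3) := h6
        _ = 2 * (C2 + C3) / q₀ * (lam * q₀ / 2) := by field_simp
        _ ≤ _ := by gcongr
    have t2' := mul_le_mul_of_nonneg_left t2 (mul_nonneg hx.1 hA0.le)
    have t3' := mul_le_mul_of_nonneg_left t3 (mul_nonneg hx.1 hmx0.le)
    nlinarith

/-- A primitive of $1/(x\,m(x))$ is $\log x/m(0)+\varphi(x)$: after the logarithm is removed the
integrand is the difference quotient of $1/m$ at $0$, which is continuous. -/
theorem exists_regular_phase {V : Set ℝ} (hV : IsOpen V) (hVc : V.OrdConnected) (h0 : 0 ∈ V)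
    {m : ℝ → ℝ} (hm : DifferentiableOn ℝ m V) (hm0 : ∀ x ∈ V, m x ≠ 0) :
    ∃ φ : ℝ → ℝ, φ 0 = 0 ∧ (∀ x ∈ V, HasDerivAt φ (dslope (fun x => 1 / m x) 0 x) x) ∧
      ContinuousOn (dslope (fun x => 1 / m x) 0) V := by
  have hd : DifferentiableOn ℝ (fun x => 1 / m x) V :=
    (differentiableOn_const _).div hm hm0
  have hk : ContinuousOn (dslope (fun x => 1 / m x) 0) V :=
    (continuousOn_dslope (hV.mem_nhds h0)).2
      ⟨hd.continuousOn, hd.differentiableAt (hV.mem_nhds h0)⟩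
  refine ⟨fun x => ∫ t in (0 : ℝ)..x, dslope (fun x => 1 / m x) 0 t, by simp, fun x hx => ?_, hk⟩
  refine intervalIntegral.integral_hasDerivAt_right ?_
    (hk.stronglyMeasurableAtFilter hV x hx) (hk.continuousAt (hV.mem_nhds hx))
  exact (hk.mono (hVc.uIcc_subset h0 hx)).intervalIntegrable

/-- The sign of the flux at `x = X` of a solution which is purely outgoing at the horizon
`x = 0`. -/
theorem horizon_flux_le {V : Set ℝ} (hV : IsOpen V) (hVc : V.OrdConnected) {X : ℝ} (hX : 0 < X)
    (hXV : Set.Icc 0 X ⊆ V) {m q a : ℝ → ℝ} (hm : ContDiffOn ℝ 1 m V) (hq : ContDiffOn ℝ 1 q V)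
    (ha : ContDiffOn ℝ 1 a V) (hm0 : ∀ x ∈ Set.Icc 0 X, 0 < m x) (hmV : ∀ x ∈ V, m x ≠ 0)
    (hq0 : ∀ x ∈ Set.Icc 0 X, 0 < q x) :
    ∃ s D m₀ lam₀ : ℝ, 0 < D ∧ 0 < m₀ ∧ 1 ≤ lam₀ ∧ ∀ lam, lam₀ ≤ lam → ∀ ω : ℂ, ω.im ≤ 0 →
      4 * -ω.im ≤ m₀ → ∀ U U' P P' Ut : ℝ → ℂ,
        (∀ x ∈ Set.Ioc 0 X, HasDerivAt U (U' x) x) →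
        (∀ x ∈ Set.Ioc 0 X, P x = ((x * m x : ℝ) : ℂ) * U' x) →
        (∀ x ∈ Set.Ioc 0 X, HasDerivAt P (P' x) x) →
        (∀ x ∈ Set.Ioc 0 X, ((x * m x : ℝ) : ℂ) * P' x
          = -(ω ^ 2 + ((x * m x * (lam * q x + a x) : ℝ) : ℂ)) * U x) →
        AnalyticAt ℝ Ut 0 →
        (∀ x ∈ Set.Ioc 0 X, U x = (x : ℂ) ^ (-(Complex.I * ω / (m 0 : ℂ))) * Ut x) →
        Real.exp (2 * -ω.im * s) * ((starRingEnd ℂ (U X)) * P X).im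
          ≤ -(ω.re - D * -ω.im * Real.sqrt lam) * Complex.normSq (Ut 0) := by
  have h0V : (0 : ℝ) ∈ V := hXV ⟨le_rfl, hX.le⟩
  obtain ⟨K, m₀, Λ, lam₀, hK, hm₀, hΛ, hlam₀, hunif⟩ :=
    exists_uniform_horizon_constants hV hX hXV hm hq ha hm0 hq0
  have hmd : DifferentiableOn ℝ m V := hm.differentiableOn one_ne_zero
  obtain ⟨φ, hφ0, hφ, hφc⟩ := exists_regular_phase hV hVc h0V hmd hmV
  set k := dslope (fun x => 1 / m x) 0 with hk
  have hm00 : m 0 ≠ 0 := hmV 0 h0V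
  set S : ℝ → ℝ := fun x => Real.log x / m 0 + φ x with hS
  have hIoc : ∀ {x}, x ∈ Set.Ioc 0 X → x ∈ Set.Icc 0 X := fun hx => ⟨hx.1.le, hx.2⟩
  have hSd : ∀ x ∈ Set.Ioc 0 X, HasDerivAt S (1 / (x * m x)) x := by
    intro x hx
    have hmx := (hm0 x (hIoc hx)).ne'
    have hx0 := hx.1.ne'
    refine (((Real.hasDerivAt_log hx0).div_const (m 0)).add (hφ x (hXV (hIoc hx)))).congr_deriv ?_
    rw [hk, dslope_of_ne _ hx0, slope_def_field]
    field_simp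
    ring
  -- The constant of `flux_estimate` with the upper bound $\Lambda\lambda$ for $A$, from which
  -- $\sqrt\lambda$ is split off; `S X` measures the factor $|e^{i\omega S}|^2$ at $x=X$.
  refine ⟨S X, 4 * Real.exp (K * X) * Real.sqrt (Λ / m₀) * Real.sqrt X, m₀, lam₀, by positivity,
    hm₀, hlam₀, ?_⟩
  intro lam hlam ω him hsmall U U' P P' Ut hU hP hPd hode hUt hUUt
  have hlam0 : 0 < lam := by linarith
  set A : ℝ → ℝ := fun x => lam * q x + a x with hA
  set e : ℝ → ℂ := fun x => Complex.exp (Complex.I * ω * (S x : ℝ)) with he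
  have hed : ∀ x ∈ Set.Ioc 0 X, HasDerivAt e
      (e x * (Complex.I * ω * ((1 / (x * m x) : ℝ) : ℂ))) x := fun x hx =>
    ((hSd x hx).ofReal_comp.const_mul (Complex.I * ω)).cexp
  set v : ℝ → ℂ := fun x => e x * U x with hv
  set z : ℝ → ℂ := fun x => e x * (P x + Complex.I * ω * U x) with hz
  have hμne : ∀ x ∈ Set.Ioc 0 X, ((x * m x : ℝ) : ℂ) ≠ 0 := by
    intro x hx
    exact_mod_cast (mul_pos hx.1 (hm0 x (hIoc hx))).ne'
  have hvd : ∀ x ∈ Set.Ioc 0 X, HasDerivAt v (z x / ((x * m x : ℝ) : ℂ)) x := by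
    intro x hx
    refine ((hed x hx).mul (hU x hx)).congr_deriv ?_
    have hne := hμne x hx
    simp only [hz, hP x hx]
    rw [Complex.ofReal_div, Complex.ofReal_one]
    generalize ((x * m x : ℝ) : ℂ) = n at *
    field_simp
    ring
  have hzd : ∀ x ∈ Set.Ioc 0 X, HasDerivAt z (2 * Complex.I * ω * z x / ((x * m x : ℝ) : ℂ)
      - (A x : ℝ) * v x) x := by
    intro x hx
    refine ((hed x hx).mul ((hPd x hx).add ((hU x hx).const_mul (Complex.I * ω)))).congr_deriv ?_
    have hne := hμne x hx
    have h1 := hode x hx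
    refine mul_left_cancel₀ hne ?_
    simp only [hz, hv, hP x hx, hA, Pi.add_apply] at h1 ⊢
    generalize e x = E
    rw [Complex.ofReal_mul _ (lam * q x + a x)] at h1
    rw [Complex.ofReal_div, Complex.ofReal_one]
    generalize ((x * m x : ℝ) : ℂ) = n at *
    field_simp
    linear_combination E * h1 - E * ω ^ 2 * U x * Complex.I_sq
  have hev : ∀ᶠ x in 𝓝[>] (0 : ℝ), x ∈ Set.Ioo 0 X := Ioo_mem_nhdsGT hX
  have hφlim : Filter.Tendsto φ (𝓝[>] 0) (𝓝 0) := by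
    have := (hφ 0 h0V).continuousAt.tendsto
    rw [hφ0] at this
    exact this.mono_left nhdsWithin_le_nhds
  have hvφ : ∀ x ∈ Set.Ioc 0 X, v x = Complex.exp (Complex.I * ω * (φ x : ℝ)) * Ut x := by
    intro x hx
    have hx0 : (x : ℂ) ≠ 0 := by exact_mod_cast hx.1.ne'
    simp only [hv, he, hS]
    rw [hUUt x hx, Complex.cpow_def_of_ne_zero hx0, ← Complex.ofReal_log hx.1.le, ← mul_assoc,
      ← Complex.exp_add]
    congr 2
    push_cast
    ring
  have hexpd : ∀ x ∈ V, HasDerivAt (fun x : ℝ => Complex.exp (Complex.I * ω * (φ x : ℝ)))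
      (Complex.exp (Complex.I * ω * (φ x : ℝ)) * (Complex.I * ω * (k x : ℝ))) x := fun x hx =>
    ((hφ x hx).ofReal_comp.const_mul (Complex.I * ω)).cexp
  have hexplim : Filter.Tendsto (fun x : ℝ => Complex.exp (Complex.I * ω * (φ x : ℝ)))
      (𝓝[>] 0) (𝓝 1) := by
    have := (hexpd 0 h0V).continuousAt.tendsto.mono_left
      (nhdsWithin_le_nhds (s := Set.Ioi (0 : ℝ)))
    simpa [hφ0] using this
  have hUtlim : Filter.Tendsto Ut (𝓝[>] 0) (𝓝 (Ut 0)) :=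
    hUt.continuousAt.tendsto.mono_left nhdsWithin_le_nhds
  have hv0 : Filter.Tendsto v (𝓝[>] 0) (𝓝 (Ut 0)) := by
    have := hexplim.mul hUtlim
    rw [one_mul] at this
    refine this.congr' ?_
    filter_upwards [hev] with x hx
    exact (hvφ x ⟨hx.1, hx.2.le⟩).symm
  set b : ℝ → ℂ := fun x => (m x : ℝ) * (Complex.exp (Complex.I * ω * (φ x : ℝ)) *
    (Complex.I * ω * (k x : ℝ)) * Ut x + Complex.exp (Complex.I * ω * (φ x : ℝ)) * deriv Ut x)
    with hb
  -- Analyticity of `Ut` makes $v'$ bounded at the horizon, so $z=\mu v'$ is $O(x)$ and $|z|^2/(\mu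
  -- A)$ tends to $0$ there.
  have hzb : ∀ᶠ x in 𝓝[>] (0 : ℝ), z x = x * b x := by
    have h1 : ∀ᶠ x in 𝓝[>] (0 : ℝ), AnalyticAt ℝ Ut x :=
      nhdsWithin_le_nhds hUt.eventually_analyticAt
    filter_upwards [hev, h1] with x hx hxa
    have hx' : x ∈ Set.Ioc 0 X := ⟨hx.1, hx.2.le⟩
    have d1 := (hexpd x (hXV (hIoc hx'))).mul hxa.differentiableAt.hasDerivAt
    have d2 : HasDerivAt v _ x := d1.congr_of_eventuallyEq (by
      filter_upwards [Ioo_mem_nhds hx.1 hx.2] with y hy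
      exact hvφ y ⟨hy.1, hy.2.le⟩)
    have h2 := (hvd x hx').unique d2
    rw [div_eq_iff (hμne x hx')] at h2
    rw [h2, hb]
    push_cast
    ring
  have hmlim : Filter.Tendsto m (𝓝[>] 0) (𝓝 (m 0)) :=
    ((hm.continuousOn.continuousAt (hV.mem_nhds h0V)).tendsto).mono_left nhdsWithin_le_nhds
  have hblim : ∃ b₀, Filter.Tendsto b (𝓝[>] 0) (𝓝 b₀) := by
    have h1 : Filter.Tendsto (fun x => ((m x : ℝ) : ℂ)) (𝓝[>] 0) (𝓝 (m 0 : ℝ)) :=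
      (Complex.continuous_ofReal.tendsto _).comp hmlim
    have h2 : Filter.Tendsto (fun x => ((k x : ℝ) : ℂ)) (𝓝[>] 0) (𝓝 (k 0 : ℝ)) :=
      (Complex.continuous_ofReal.tendsto _).comp
        ((hφc.continuousAt (hV.mem_nhds h0V)).tendsto.mono_left nhdsWithin_le_nhds)
    have h3 : Filter.Tendsto (deriv Ut) (𝓝[>] 0) (𝓝 (deriv Ut 0)) :=
      hUt.deriv.continuousAt.tendsto.mono_left nhdsWithin_le_nhds
    exact ⟨_, h1.mul (((hexplim.mul (h2.const_mul (Complex.I * ω))).mul hUtlim).add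
      (hexplim.mul h3))⟩
  obtain ⟨b₀, hb₀⟩ := hblim
  have hxlim : Filter.Tendsto (fun x : ℝ => x) (𝓝[>] 0) (𝓝 0) :=
    (Filter.tendsto_id (x := 𝓝 (0 : ℝ))).mono_left nhdsWithin_le_nhds
  have hz0 : Filter.Tendsto z (𝓝[>] 0) (𝓝 0) := by
    have := ((Complex.continuous_ofReal.tendsto _).comp hxlim).mul hb₀
    rw [Complex.ofReal_zero, zero_mul] at this
    refine this.congr' ?_
    filter_upwards [hzb] with x hx
    exact hx.symm
  have hAlim : Filter.Tendsto A (𝓝[>] 0) (𝓝 (A 0)) :=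
    ((((hq.continuousOn.const_smul lam).add ha.continuousOn).continuousAt
      (hV.mem_nhds h0V)).tendsto).mono_left nhdsWithin_le_nhds
  have hmA0 : m 0 * A 0 ≠ 0 :=
    mul_ne_zero hm00 (hunif lam hlam 0 ⟨le_rfl, hX.le⟩).2.1.ne'
  have hz0' : Filter.Tendsto (fun x => Complex.normSq (z x) / (x * m x * A x)) (𝓝[>] 0) (𝓝 0) := by
    have := (hxlim.mul ((Complex.continuous_normSq.tendsto _).comp hb₀)).div
      (hmlim.mul hAlim) hmA0
    rw [zero_mul, zero_div] at this
    refine this.congr' ?_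
    filter_upwards [hzb, hev] with x hx hx'
    have := hx'.1.ne'
    have h1 := (hm0 x ⟨hx'.1.le, hx'.2.le⟩).ne'
    have h2 := (hunif lam hlam x ⟨hx'.1.le, hx'.2.le⟩).2.1.ne'
    rw [hx, map_mul, Complex.normSq_ofReal]
    simp only [Pi.div_apply, Function.comp]
    change A x ≠ 0 at h2
    field_simp
  have hderiv : ∀ {f : ℝ → ℝ}, ContDiffOn ℝ 1 f V → ∀ x ∈ Set.Ioc 0 X,
      HasDerivAt f (deriv f x) x := fun hf x hx =>
    ((hf.differentiableOn one_ne_zero).differentiableAt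
      (hV.mem_nhds (hXV (hIoc hx)))).hasDerivAt
  have key := flux_estimate (μ := fun x => x * m x) (A := A)
    (μ' := fun x => m x + x * deriv m x) (A' := fun x => lam * deriv q x + deriv a x)
    (Λ := Λ * lam) hX hK hm₀ him hvd hzd
    (fun x hx => ((hasDerivAt_id x).mul (hderiv hm x hx)).congr_deriv (by simp))
    (fun x hx => ((hderiv hq x hx).const_mul lam).add (hderiv ha x hx))
    (fun x hx => by
      rw [mul_comm]
      exact mul_le_mul_of_nonneg_left (hunif lam hlam x (hIoc hx)).1 hx.1.le)
    (fun x hx => (hunif lam hlam x (hIoc hx)).2.1)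
    (fun x hx => (hunif lam hlam x (hIoc hx)).2.2.1)
    (fun x hx => by
      have := (hunif lam hlam x (hIoc hx)).2.2.2 (-ω.im) hsmall
      simp only [hA]
      linarith)
    hv0 hz0 hz0'
  have hnorm : Complex.normSq (e X) = Real.exp (2 * -ω.im * S X) := by
    rw [Complex.normSq_eq_norm_sq, he, Complex.norm_exp, ← Real.exp_nat_mul]
    congr 1
    simp [Complex.mul_re, Complex.mul_im]
    ring
  have hflux : ((starRingEnd ℂ (v X)) * z X).im - ω.re * Complex.normSq (v X)
      = Real.exp (2 * -ω.im * S X) * ((starRingEnd ℂ (U X)) * P X).im := by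
    rw [← hnorm]
    simp only [hv, hz, map_mul, Complex.normSq_apply, Complex.mul_re, Complex.mul_im,
      Complex.conj_re, Complex.conj_im, Complex.add_re, Complex.add_im, Complex.I_re, Complex.I_im]
    ring
  have hsqrt : Real.sqrt (Λ * lam / m₀) = Real.sqrt (Λ / m₀) * Real.sqrt lam := by
    rw [← Real.sqrt_mul (by positivity)]
    congr 1
    ring
  rw [hflux, hsqrt] at key
  have := (abs_le.1 key).2
  nlinarith

/-! ### The radial equation in tortoise form, Wronskians and fluxes in the interior. -/

namespace RNAdS

/-- The derivative of `Δ / r²`. -/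
def dh (p : RNAdS) (r : ℝ) : ℝ :=
  (2 * r - 2 * p.M + 4 * r ^ 3 / p.l ^ 2) / r ^ 2 - 2 * p.Δ r / r ^ 3

theorem hasDerivAt_h (p : RNAdS) {r : ℝ} (hr : r ≠ 0) :
    HasDerivAt (fun r => p.Δ r / r ^ 2) (p.dh r) r := by
  refine ((p.hasDerivAt_Δ r).div (hasDerivAt_pow 2 r) (pow_ne_zero 2 hr)).congr_deriv ?_
  unfold dh
  have hl := p.l_pos.ne'
  field_simp
  norm_num
  ring

/-- The derivative of `r R` with respect to the tortoise coordinate. -/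
def tortoiseDeriv (p : RNAdS) (R : ℝ → ℂ) (r : ℝ) : ℂ :=
  ((p.Δ r / r ^ 2 : ℝ) : ℂ) * (R r + r * deriv R r)

/-- The Wronskian of two radial functions, weighted so that it is constant on solutions. -/
def wronskian (p : RNAdS) (R₁ R₂ : ℝ → ℂ) (r : ℝ) : ℂ :=
  (p.Δ r : ℂ) * (R₁ r * deriv R₂ r - deriv R₁ r * R₂ r)

namespace SolvesRadial

variable {p : RNAdS} {ω : ℂ} {ℓ : ℕ} {R R₁ R₂ : ℝ → ℂ} {s : Set ℝ} {r : ℝ}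

theorem hasDerivAt (h : p.SolvesRadial ω ℓ R s) (hs : IsOpen s) (hr : r ∈ s) :
    HasDerivAt R (deriv R r) r :=
  ((h.1.differentiableOn two_ne_zero).differentiableAt (hs.mem_nhds hr)).hasDerivAt

theorem hasDerivAt_Δ_deriv (h : p.SolvesRadial ω ℓ R s) (hs : IsOpen s) (hr : r ∈ s) :
    HasDerivAt (fun x : ℝ => (p.Δ x : ℂ) * deriv R x)
      (deriv (fun x : ℝ => (p.Δ x : ℂ) * deriv R x) r) r := by
  have h1 : ContDiffOn ℝ 1 (deriv R) s := h.1.deriv_of_isOpen hs (by norm_num)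
  have h2 := (h1.differentiableOn one_ne_zero).differentiableAt (hs.mem_nhds hr)
  exact ((p.hasDerivAt_Δ r).ofReal_comp.differentiableAt.mul h2).hasDerivAt

theorem hasDerivAt_mul (h : p.SolvesRadial ω ℓ R s) (hs : IsOpen s) (hr : r ∈ s) :
    HasDerivAt (fun r : ℝ => (r : ℂ) * R r) (R r + r * deriv R r) r :=
  ((hasDerivAt_id r).ofReal_comp.mul (h.hasDerivAt hs hr)).congr_deriv (by simp)

theorem hasDerivAt_tortoiseDeriv (h : p.SolvesRadial ω ℓ R s) (hs : IsOpen s) (hr : r ∈ s)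
    (hr0 : r ≠ 0) : HasDerivAt (p.tortoiseDeriv R) ((p.dh r : ℂ) * R r +
      deriv (fun x : ℝ => (p.Δ x : ℂ) * deriv R x) r / r) r := by
  have hrc : (r : ℂ) ≠ 0 := by exact_mod_cast hr0
  have h1 := ((p.hasDerivAt_h hr0).ofReal_comp.mul (h.hasDerivAt hs hr)).add
    ((h.hasDerivAt_Δ_deriv hs hr).div (hasDerivAt_id r).ofReal_comp hrc)
  refine (h1.congr_of_eventuallyEq ?_).congr_deriv ?_
  · filter_upwards [isOpen_ne.mem_nhds hr0] with x hx
    have hxc : (x : ℂ) ≠ 0 := by exact_mod_cast hx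
    simp only [tortoiseDeriv, Pi.add_apply, Pi.mul_apply, Pi.div_apply, id]
    push_cast
    field_simp
  · simp only [id]
    push_cast
    field_simp
    ring

theorem tortoise_equation (h : p.SolvesRadial ω ℓ R s) (hr : r ∈ s) (hr0 : r ≠ 0) :
    ((p.Δ r / r ^ 2 : ℝ) : ℂ) * ((p.dh r : ℂ) * R r +
        deriv (fun x : ℝ => (p.Δ x : ℂ) * deriv R x) r / r)
      = -(ω ^ 2 - ((p.Δ r / r ^ 2 * ((ℓ : ℝ) * (ℓ + 1) * (1 / r ^ 2) +
        (p.dh r / r - p.α / p.l ^ 2)) : ℝ) : ℂ)) * (r * R r) := by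
  have hrc : (r : ℂ) ≠ 0 := by exact_mod_cast hr0
  have hl : (p.l : ℂ) ≠ 0 := by exact_mod_cast p.l_pos.ne'
  have h1 := h.2 r hr
  generalize deriv (fun x : ℝ => (p.Δ x : ℂ) * deriv R x) r = D at *
  push_cast at h1 ⊢
  have h2 : (r : ℂ) * (p.Δ r / r ^ 4 * D + ω ^ 2 * R r - ℓ * (ℓ + 1) * (p.Δ r / r ^ 4) * R r +
      p.α / p.l ^ 2 * (p.Δ r / r ^ 2) * R r) = 0 := by rw [h1, mul_zero]
  rw [← sub_eq_zero, ← h2]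
  field_simp
  ring

theorem hasDerivAt_wronskian (h₁ : p.SolvesRadial ω ℓ R₁ s) (h₂ : p.SolvesRadial ω ℓ R₂ s)
    (hs : IsOpen s) (hr : r ∈ s) (hr0 : r ≠ 0) (hΔ : p.Δ r ≠ 0) :
    HasDerivAt (p.wronskian R₁ R₂) 0 r := by
  have hrc : (r : ℂ) ≠ 0 := by exact_mod_cast hr0
  have hΔc : (p.Δ r : ℂ) ≠ 0 := by exact_mod_cast hΔ
  have hd := ((h₁.hasDerivAt hs hr).mul (h₂.hasDerivAt_Δ_deriv hs hr)).sub
    ((h₁.hasDerivAt_Δ_deriv hs hr).mul (h₂.hasDerivAt hs hr))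
  refine (hd.congr_of_eventuallyEq (Filter.Eventually.of_forall fun x => ?_)).congr_deriv ?_
  · simp only [wronskian, Pi.sub_apply, Pi.mul_apply]
    ring
  · have e1 := h₁.2 r hr
    have e2 := h₂.2 r hr
    generalize deriv (fun x : ℝ => (p.Δ x : ℂ) * deriv R₁ x) r = D1 at *
    generalize deriv (fun x : ℝ => (p.Δ x : ℂ) * deriv R₂ x) r = D2 at *
    have hne : ((p.Δ r / r ^ 4 : ℝ) : ℂ) ≠ 0 := by
      push_cast
      exact div_ne_zero hΔc (pow_ne_zero 4 hrc)
    refine mul_left_cancel₀ hne ?_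
    linear_combination R₁ r * e2 - R₂ r * e1

end SolvesRadial

theorem Δ_neg (p : RNAdS) {r : ℝ} (hr : r ∈ Set.Ioo p.rm p.rp) : p.Δ r < 0 := by
  rw [p.Δ_eq]
  have h1 := p.quad_pos (p.rm_pos.trans hr.1).le
  have h2 := p.l_pos
  refine div_neg_of_neg_of_pos (mul_neg_of_neg_of_pos ?_ h1) (by positivity)
  exact mul_neg_of_pos_of_neg (sub_pos.2 hr.1) (sub_neg.2 hr.2)

/-- The midpoint of the interior `(r₋, r₊)`. -/
def mid (p : RNAdS) : ℝ := (p.rm + p.rp) / 2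

theorem mid_mem (p : RNAdS) : p.mid ∈ Set.Ioo p.rm p.rp := by
  have := p.rm_lt_rp
  unfold mid
  constructor <;> linarith

theorem wronskian_eq_wronskian_mid {p : RNAdS} {ω : ℂ} {ℓ : ℕ} {R₁ R₂ : ℝ → ℂ}
    (h₁ : p.SolvesRadial ω ℓ R₁ (Set.Ioo p.rm p.rp))
    (h₂ : p.SolvesRadial ω ℓ R₂ (Set.Ioo p.rm p.rp)) {r : ℝ} (hr : r ∈ Set.Ioo p.rm p.rp) :
    p.wronskian R₁ R₂ r = p.wronskian R₁ R₂ p.mid := by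
  have hd : ∀ x ∈ Set.Ioo p.rm p.rp, HasDerivAt (p.wronskian R₁ R₂) 0 x := fun x hx =>
    h₁.hasDerivAt_wronskian h₂ isOpen_Ioo hx (p.rm_pos.trans hx.1).ne' (p.Δ_neg hx).ne
  exact isOpen_Ioo.is_const_of_deriv_eq_zero isPreconnected_Ioo
    (fun x hx => (hd x hx).differentiableAt.differentiableWithinAt)
    (fun x hx => (hd x hx).deriv) hr p.mid_mem

/-- In the distance $x$ to either horizon, $u_{\mathcal H_R}$ at $r_+$ and $u_{\mathcal{CH}_R}$ at
$r_-$ have the same form $x^{-i\omega/(2\kappa)}$ times an analytic function. One statement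
therefore serves both, with $\sigma$ recording the direction in which $r$ varies with $x$. -/
theorem radial_flux_le (p : RNAdS) {r₀ σ κ : ℝ}
    (hside : (σ = 1 ∧ r₀ = p.rm ∧ κ = p.κm) ∨ (σ = -1 ∧ r₀ = p.rp ∧ κ = p.κp)) :
    ∃ s D m₀ lam₀ : ℝ, 0 < D ∧ 0 < m₀ ∧ 1 ≤ lam₀ ∧ ∀ ℓ : ℕ, lam₀ ≤ (ℓ : ℝ) * (ℓ + 1) →
      ∀ ω : ℂ, ω.im ≤ 0 → 4 * -ω.im ≤ m₀ → ∀ R Rt : ℝ → ℂ,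
        p.SolvesRadial ω ℓ R (Set.Ioo p.rm p.rp) → AnalyticAt ℝ Rt r₀ → Rt r₀ = 1 →
        (∀ r ∈ Set.Ioo p.rm p.rp,
          R r = ((|r - r₀| : ℝ) : ℂ) ^ (-(Complex.I * ω / (2 * (κ : ℂ)))) * Rt r) →
        Real.exp (2 * -ω.im * s) *
            ((starRingEnd ℂ (p.mid * R p.mid)) * (-σ * p.tortoiseDeriv R p.mid)).im
          ≤ -(ω.re - D * -ω.im * Real.sqrt ((ℓ : ℝ) * (ℓ + 1))) * r₀ ^ 2 := by
  have hlt := p.rm_lt_rp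
  have hrm := p.rm_pos
  have hrp := p.rp_pos
  have hl := p.l_pos
  have hσ : σ * σ = 1 := by rcases hside with h | h <;> simp [h.1]
  set X := (p.rp - p.rm) / 2 with hXdef
  have hX : 0 < X := by rw [hXdef]; linarith
  set V : Set ℝ := {x | 0 < r₀ + σ * x} ∩ Set.Iio (2 * X) with hVdef
  have hVo : IsOpen V := (isOpen_lt continuous_const (by fun_prop)).inter isOpen_Iio
  have hVc : V.OrdConnected := by
    refine Set.OrdConnected.inter ?_ Set.ordConnected_Iio
    refine ⟨fun x hx y hy t ht => ?_⟩
    simp only [Set.mem_ofPred_eq] at hx hy ⊢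
    rcases hside with h | h <;> rw [h.1] at hx hy ⊢ <;> linarith [ht.1, ht.2]
  have hmem : ∀ x ∈ Set.Ioc 0 X, r₀ + σ * x ∈ Set.Ioo p.rm p.rp := by
    intro x hx
    have h1 := hx.1; have h2 := hx.2
    rcases hside with h | h <;> rw [h.1, h.2.1] <;> constructor <;> linarith
  have hXV : Set.Icc 0 X ⊆ V := by
    intro x hx
    have h1 := hx.1; have h2 := hx.2
    refine ⟨?_, by simp only [Set.mem_Iio]; linarith⟩
    simp only [Set.mem_ofPred_eq]
    rcases hside with h | h <;> rw [h.1, h.2.1] <;> linarith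
  have hVpos : ∀ x ∈ V, 0 < r₀ + σ * x := fun x hx => hx.1
  have hr : ContDiff ℝ 1 fun x => r₀ + σ * x := by fun_prop
  -- Chosen so that $x\,m(x)=-\Delta/r^2$ and $m(0)=2\kappa$; the factor $2X-x$ is the distance to
  -- the other horizon.
  set m : ℝ → ℝ := fun x => (2 * X - x) * p.quad (r₀ + σ * x) / (p.l ^ 2 * (r₀ + σ * x) ^ 2)
    with hm
  have hm0 : ∀ x ∈ V, 0 < m x := by
    intro x hx
    have h1 := hVpos x hx
    have h2 := p.quad_pos h1.le
    have h3 : 0 < 2 * X - x := sub_pos.2 hx.2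
    simp only [hm]; positivity
  have hmC : ContDiffOn ℝ 1 m V := by
    refine ContDiffOn.div ?_ ?_ fun x hx => ?_
    · unfold quad; fun_prop
    · fun_prop
    · have := hVpos x hx
      positivity
  have hqC : ContDiffOn ℝ 1 (fun x => 1 / (r₀ + σ * x) ^ 2) V := by
    refine ContDiffOn.div contDiffOn_const (by fun_prop) fun x hx => ?_
    have := hVpos x hx
    positivity
  have haC : ContDiffOn ℝ 1 (fun x => p.dh (r₀ + σ * x) / (r₀ + σ * x) - p.α / p.l ^ 2) V := by
    refine ContDiffOn.sub (ContDiffOn.div ?_ (by fun_prop) fun x hx => (hVpos x hx).ne')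
      contDiffOn_const
    unfold dh Δ
    refine ContDiffOn.sub (ContDiffOn.div (by fun_prop) (by fun_prop) fun x hx => ?_)
      (ContDiffOn.div (by fun_prop) (by fun_prop) fun x hx => ?_)
    all_goals
      have := hVpos x hx
      positivity
  obtain ⟨s, D, m₀, lam₀, hD, hm₀, hlam₀, hmain⟩ := horizon_flux_le hVo hVc hX hXV hmC hqC haC
    (fun x hx => hm0 x (hXV hx)) (fun x hx => (hm0 x hx).ne')
    (fun x hx => by
      have := hVpos x (hXV hx)
      positivity)
  refine ⟨s, D, m₀, lam₀, hD, hm₀, hlam₀, ?_⟩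
  intro ℓ hℓ ω him hsmall R Rt hsol hRt hRt0 hRRt
  have hmκ : m 0 = 2 * κ := by
    rcases hside with h | h
    · rw [h.2.2, p.two_mul_κm]
      simp only [hm, h.2.1, hXdef]
      ring_nf
    · rw [h.2.2, p.two_mul_κp]
      simp only [hm, h.2.1, hXdef]
      ring_nf
  have hμ : ∀ x, r₀ + σ * x ≠ 0 → x * m x = -(p.Δ (r₀ + σ * x) / (r₀ + σ * x) ^ 2) := by
    intro x hx
    rw [p.Δ_eq]
    have hl' := hl.ne'
    rcases hside with h | h <;>
    · simp only [hm, hXdef, h.1, h.2.1] at hx ⊢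
      generalize p.quad _ = Q
      field_simp
      ring
  have hmid : r₀ + σ * X = p.mid := by
    rcases hside with h | h <;> rw [h.1, h.2.1, hXdef, mid] <;> ring
  have hcomp : ∀ {f : ℝ → ℂ} {f' : ℂ} {x : ℝ}, HasDerivAt f f' (r₀ + σ * x) →
      HasDerivAt (fun x => f (r₀ + σ * x)) (σ * f') x := by
    intro f f' x hf
    have h1 : HasDerivAt (fun x => r₀ + σ * x) σ x := by
      simpa using ((hasDerivAt_id x).const_mul σ).const_add r₀
    exact (hf.scomp x h1).congr_deriv Complex.real_smul
  have hfin := hmain ((ℓ : ℝ) * (ℓ + 1)) hℓ ω him hsmall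
    (fun x => ((r₀ + σ * x : ℝ) : ℂ) * R (r₀ + σ * x))
    (fun x => σ * (R (r₀ + σ * x) + ((r₀ + σ * x : ℝ) : ℂ) * deriv R (r₀ + σ * x)))
    (fun x => -σ * p.tortoiseDeriv R (r₀ + σ * x))
    (fun x => -σ * (σ * ((p.dh (r₀ + σ * x) : ℂ) * R (r₀ + σ * x) +
      deriv (fun x : ℝ => (p.Δ x : ℂ) * deriv R x) (r₀ + σ * x) / ((r₀ + σ * x : ℝ) : ℂ))))
    (fun x => ((r₀ + σ * x : ℝ) : ℂ) * Rt (r₀ + σ * x))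
    (fun x hx => hcomp (hsol.hasDerivAt_mul isOpen_Ioo (hmem x hx)))
    (fun x hx => by
      have h1 := hVpos x (hXV ⟨hx.1.le, hx.2⟩)
      rw [hμ x h1.ne', tortoiseDeriv]
      push_cast
      ring)
    (fun x hx => by
      have h1 := hVpos x (hXV ⟨hx.1.le, hx.2⟩)
      exact (hcomp (hsol.hasDerivAt_tortoiseDeriv isOpen_Ioo (hmem x hx) h1.ne')).const_mul _)
    (fun x hx => by
      have h1 := hVpos x (hXV ⟨hx.1.le, hx.2⟩)
      have h2 := hsol.tortoise_equation (hmem x hx) h1.ne'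
      have hσc : (σ : ℂ) * σ = 1 := by exact_mod_cast hσ
      rw [hμ x h1.ne']
      rw [neg_mul (p.Δ (r₀ + σ * x) / (r₀ + σ * x) ^ 2), Complex.ofReal_neg, Complex.ofReal_neg,
        ← sub_eq_add_neg, ← h2]
      linear_combination (((p.Δ (r₀ + σ * x) / (r₀ + σ * x) ^ 2 : ℝ) : ℂ) *
        ((p.dh (r₀ + σ * x) : ℂ) * R (r₀ + σ * x) +
        deriv (fun x : ℝ => (p.Δ x : ℂ) * deriv R x) (r₀ + σ * x) / ((r₀ + σ * x : ℝ) : ℂ))) * hσc)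
    (by
      have h1 : AnalyticAt ℝ (fun x : ℝ => r₀ + σ * x) 0 := by fun_prop
      refine AnalyticAt.mul ((Complex.ofRealCLM.analyticAt _).comp h1) ?_
      exact AnalyticAt.fun_comp (by simpa using hRt) h1)
    (fun x hx => by
      have h1 : |r₀ + σ * x - r₀| = x := by
        rcases hside with h | h <;> rw [h.1] <;> simp [abs_of_pos hx.1]
      rw [hRRt _ (hmem x hx), h1, hmκ]
      push_cast
      ring)
  rw [hmid] at hfin
  refine hfin.trans_eq ?_
  simp only [mul_zero, add_zero, hRt0, mul_one, Complex.normSq_ofReal]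
  ring


/-! ### Lower bounds for the Wronskian and the transmission coefficient. -/

/-- The Wronskian of two waves is bounded below by their fluxes. -/
theorem four_mul_flux_mul_flux_le (a a' b b' : ℂ) :
    4 * ((starRingEnd ℂ a) * a').im * ((starRingEnd ℂ b) * b').im
      ≤ Complex.normSq (a * b' + a' * b) := by
  have h : Complex.normSq (a * b' + a' * b) = 4 * ((starRingEnd ℂ a) * a').im *
      ((starRingEnd ℂ b) * b').im + Complex.normSq ((starRingEnd ℂ a) * b' +
        (starRingEnd ℂ a') * b) := by
    simp only [Complex.normSq_apply, Complex.mul_re, Complex.mul_im, Complex.add_re,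
      Complex.add_im, Complex.conj_re, Complex.conj_im]
    ring
  rw [h]
  linarith [Complex.normSq_nonneg ((starRingEnd ℂ a) * b' + (starRingEnd ℂ a') * b)]

theorem wronskian_eq_tortoiseDeriv (p : RNAdS) (R₁ R₂ : ℝ → ℂ) {r : ℝ} (hr : r ≠ 0) :
    p.wronskian R₁ R₂ r
      = r * R₁ r * p.tortoiseDeriv R₂ r - p.tortoiseDeriv R₁ r * (r * R₂ r) := by
  have hrc : (r : ℂ) ≠ 0 := by exact_mod_cast hr
  unfold wronskian tortoiseDeriv
  push_cast
  field_simp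
  ring

/-- Scattering from the event horizon to the Cauchy horizon: a lower bound for the Wronskian of
the solutions `R_{H_R}` and `R_{CH_R}`. -/
theorem exists_wronskian_lower_bound (p : RNAdS) :
    ∃ s D m₀ lam₀ : ℝ, 0 < D ∧ 0 < m₀ ∧ ∀ ℓ : ℕ, lam₀ ≤ (ℓ : ℝ) * (ℓ + 1) →
      ∀ ω : ℂ, ω.im ≤ 0 → 4 * -ω.im ≤ m₀ →
        D * -ω.im * Real.sqrt ((ℓ : ℝ) * (ℓ + 1)) ≤ ω.re / 2 → ∀ RH RC : ℝ → ℂ,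
        p.IsRHR ω ℓ RH → p.IsRCHR ω ℓ RC →
        Real.exp (-(-ω.im * s)) * (ω.re * (p.rp * p.rm)) ≤ ‖p.wronskian RH RC p.mid‖ := by
  obtain ⟨s₁, D₁, m₁, lam₁, hD₁, hm₁, -, h₁⟩ :=
    p.radial_flux_le (σ := -1) (Or.inr ⟨rfl, rfl, rfl⟩)
  obtain ⟨s₂, D₂, m₂, lam₂, hD₂, hm₂, -, h₂⟩ :=
    p.radial_flux_le (σ := 1) (Or.inl ⟨rfl, rfl, rfl⟩)
  refine ⟨s₁ + s₂, max D₁ D₂, min m₁ m₂, max lam₁ lam₂, lt_max_of_lt_left hD₁, lt_min hm₁ hm₂, ?_⟩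
  rintro ℓ hℓ ω him hsmall hD RH RC ⟨hHsol, Ht, hHan, hH1, hHeq⟩ ⟨hCsol, Ct, hCan, hC1, hCeq⟩
  have hlt := p.rm_lt_rp
  have hrm := p.rm_pos
  have hrp := p.rp_pos
  have him' : 0 ≤ -ω.im := by linarith
  have hsub : Set.Ioo p.rm p.rp ⊆ Set.Ioi p.rm \ {p.rp} := fun r hr => ⟨hr.1, hr.2.ne⟩
  have hHsol' : p.SolvesRadial ω ℓ RH (Set.Ioo p.rm p.rp) :=
    ⟨hHsol.1.mono hsub, fun r hr => hHsol.2 r (hsub hr)⟩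
  have k₁ := h₁ ℓ ((le_max_left _ _).trans hℓ) ω him (hsmall.trans (min_le_left _ _)) RH Ht hHsol'
    (hHan _ hlt) hH1 (fun r hr => hHeq r (hsub hr))
  have k₂ := h₂ ℓ ((le_max_right _ _).trans hℓ) ω him (hsmall.trans (min_le_right _ _)) RC Ct hCsol
    (hCan _ ⟨le_rfl, hlt⟩) hC1 (fun r hr => by
      rw [hCeq r hr, abs_of_pos (sub_pos.2 hr.1)])
  have hsq := Real.sqrt_nonneg ((ℓ : ℝ) * (ℓ + 1))
  set q := Real.sqrt ((ℓ : ℝ) * (ℓ + 1))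
  have b₁ : D₁ * -ω.im * q ≤ ω.re / 2 :=
    le_trans (by gcongr; exact le_max_left _ _) hD
  have b₂ : D₂ * -ω.im * q ≤ ω.re / 2 :=
    le_trans (by gcongr; exact le_max_right _ _) hD
  have hre : 0 ≤ ω.re := by
    have : 0 ≤ D₁ * -ω.im * q := by positivity
    linarith
  set J₁ := ((starRingEnd ℂ (p.mid * RH p.mid)) * (-((-1 : ℝ) : ℂ) * p.tortoiseDeriv RH p.mid)).im
  set J₂ := ((starRingEnd ℂ (p.mid * RC p.mid)) * (-((1 : ℝ) : ℂ) * p.tortoiseDeriv RC p.mid)).im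
  -- At most half of each flux is lost. Since `J₂` is taken against the direction of $r^*$, both
  -- fluxes are nonpositive and their product is bounded below.
  have j₁ : ω.re / 2 * p.rp ^ 2 ≤ Real.exp (2 * -ω.im * s₁) * -J₁ := by
    nlinarith [mul_le_mul_of_nonneg_right b₁ (sq_nonneg p.rp)]
  have j₂ : ω.re / 2 * p.rm ^ 2 ≤ Real.exp (2 * -ω.im * s₂) * -J₂ := by
    nlinarith [mul_le_mul_of_nonneg_right b₂ (sq_nonneg p.rm)]
  have hW : 4 * J₁ * J₂ ≤ ‖p.wronskian RH RC p.mid‖ ^ 2 := by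
    have := four_mul_flux_mul_flux_le (p.mid * RH p.mid) (-((-1 : ℝ) : ℂ) *
      p.tortoiseDeriv RH p.mid) (p.mid * RC p.mid) (-((1 : ℝ) : ℂ) * p.tortoiseDeriv RC p.mid)
    refine this.trans_eq ?_
    rw [← Complex.normSq_eq_norm_sq, p.wronskian_eq_tortoiseDeriv RH RC
      (hrm.trans p.mid_mem.1).ne', ← Complex.normSq_neg]
    congr 1
    push_cast
    ring
  refine le_of_sq_le_sq ?_ (norm_nonneg _)
  have hprod := mul_le_mul j₁ j₂ (by positivity) (le_trans (by positivity) j₁)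
  have e1 : Real.exp (2 * -ω.im * s₁) * Real.exp (2 * -ω.im * s₂)
      = Real.exp (2 * (-ω.im * (s₁ + s₂))) := by
    rw [← Real.exp_add]; ring_nf
  have e2 : Real.exp (-(-ω.im * (s₁ + s₂))) ^ 2 * Real.exp (2 * (-ω.im * (s₁ + s₂))) = 1 := by
    rw [← Real.exp_nat_mul, ← Real.exp_add]
    simp
  have h3 : (ω.re * (p.rp * p.rm)) ^ 2 ≤ Real.exp (2 * (-ω.im * (s₁ + s₂))) * (4 * J₁ * J₂) := by
    rw [← e1]; nlinarith
  rw [mul_pow]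
  calc _ ≤ Real.exp (-(-ω.im * (s₁ + s₂))) ^ 2 *
        (Real.exp (2 * (-ω.im * (s₁ + s₂))) * (4 * J₁ * J₂)) := by gcongr
    _ = 4 * J₁ * J₂ := by rw [← mul_assoc, e2, one_mul]
    _ ≤ _ := hW

/-- The Wronskian is constant, so it equals its limit at $r_-$. The two powers of $r-r_-$ cancel,
and only the difference $-2\rho$ of the exponents survives, multiplied by $\Delta/(r-r_-)$ at $r_-$.
-/
theorem wronskian_RCHL_RCHR (p : RNAdS) {ω : ℂ} {ℓ : ℕ} {RL RR : ℝ → ℂ} (hL : p.IsRCHL ω ℓ RL)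
    (hR : p.IsRCHR ω ℓ RR) : p.wronskian RL RR p.mid = 2 * Complex.I * ω * p.rm ^ 2 := by
  obtain ⟨hLsol, Lt, hLan, hL1, hLeq⟩ := hL
  obtain ⟨hRsol, Rt, hRan, hR1, hReq⟩ := hR
  have hlt := p.rm_lt_rp
  have hκ : (p.κm : ℂ) ≠ 0 := by exact_mod_cast p.κm_pos.ne'
  set ρ := Complex.I * ω / (2 * (p.κm : ℂ)) with hρ
  set B : ℝ → ℝ := fun r => (r - p.rp) * p.quad r / p.l ^ 2 with hB
  have hΔB : ∀ r, p.Δ r = (r - p.rm) * B r := fun r => by rw [p.Δ_eq, hB]; ring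
  have hderiv : ∀ (τ : ℂ) (R Q : ℝ → ℂ), AnalyticOnNhd ℝ Q (Set.Ico p.rm p.rp) →
      (∀ r ∈ Set.Ioo p.rm p.rp, R r = ((r - p.rm : ℝ) : ℂ) ^ τ * Q r) → ∀ r ∈ Set.Ioo p.rm p.rp,
      ((r : ℂ) - p.rm) * deriv R r
        = ((r - p.rm : ℝ) : ℂ) ^ τ * (τ * Q r + ((r : ℂ) - p.rm) * deriv Q r) := by
    intro τ R Q hQ hRQ r hr
    have hx : 0 < r - p.rm := sub_pos.2 hr.1
    have hxc : (r : ℂ) - p.rm ≠ 0 := by exact_mod_cast hx.ne'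
    have h1 : HasDerivAt (fun r : ℝ => ((|r - p.rm| : ℝ) : ℂ) ^ τ)
        (((|r - p.rm| : ℝ) : ℂ) ^ τ * (τ / ((r - p.rm : ℝ) : ℂ))) r := by
      have := (hasDerivAt_ofReal_abs_cpow hx.ne' τ).scomp r ((hasDerivAt_id r).sub_const p.rm)
      exact this.congr_deriv (one_smul _ _)
    have h2 := h1.mul (hQ r ⟨hr.1.le, hr.2⟩).differentiableAt.hasDerivAt
    have h3 : HasDerivAt R _ r := h2.congr_of_eventuallyEq (by
      filter_upwards [Ioo_mem_nhds hr.1 hr.2] with y hy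
      rw [hRQ y hy, Pi.mul_apply, abs_of_pos (sub_pos.2 hy.1)])
    rw [h3.deriv, abs_of_pos hx]
    push_cast
    field_simp
  have hform : ∀ r ∈ Set.Ioo p.rm p.rp, p.wronskian RL RR r
      = B r * (((r : ℂ) - p.rm) * (Lt r * deriv Rt r - deriv Lt r * Rt r)
        - 2 * ρ * (Lt r * Rt r)) := by
    intro r hr
    have hxc : ((r - p.rm : ℝ) : ℂ) ≠ 0 := by exact_mod_cast (sub_pos.2 hr.1).ne'
    have d1 := hderiv _ _ _ hLan hLeq r hr
    have d2 := hderiv _ _ _ hRan hReq r hr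
    have hinv : ((r - p.rm : ℝ) : ℂ) ^ ρ * ((r - p.rm : ℝ) : ℂ) ^ (-ρ) = 1 := by
      rw [← Complex.cpow_add _ _ hxc]; simp
    have h1 : p.wronskian RL RR r = B r * (RL r * (((r : ℂ) - p.rm) * deriv RR r)
        - (((r : ℂ) - p.rm) * deriv RL r) * RR r) := by
      rw [wronskian, hΔB]; push_cast; ring
    rw [h1, d1, d2, hLeq r hr, hReq r hr]
    linear_combination (B r : ℂ) * (((r : ℂ) - p.rm) * (Lt r * deriv Rt r - deriv Lt r * Rt r)
        - 2 * ρ * (Lt r * Rt r)) * hinv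
  have hmem : p.rm ∈ Set.Ico p.rm p.rp := ⟨le_rfl, hlt⟩
  have hcont : ContinuousAt (fun r : ℝ => (B r : ℂ) * (((r : ℂ) - p.rm) *
      (Lt r * deriv Rt r - deriv Lt r * Rt r) - 2 * ρ * (Lt r * Rt r))) p.rm := by
    have c1 := (hLan _ hmem).continuousAt
    have c2 := (hRan _ hmem).continuousAt
    have c3 := (hLan _ hmem).deriv.continuousAt
    have c4 := (hRan _ hmem).deriv.continuousAt
    have c5 : ContinuousAt (fun r : ℝ => (B r : ℂ)) p.rm := by
      simp only [hB]; unfold quad; fun_prop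
    fun_prop
  have hlim := hcont.tendsto.mono_left (nhdsWithin_le_nhds (s := Set.Ioi p.rm))
  have hev : ∀ᶠ r in 𝓝[>] p.rm, r ∈ Set.Ioo p.rm p.rp := Ioo_mem_nhdsGT hlt
  have hconst : Filter.Tendsto (fun _ : ℝ => p.wronskian RL RR p.mid) (𝓝[>] p.rm)
      (𝓝 (p.wronskian RL RR p.mid)) := tendsto_const_nhds
  have hlim' := hlim.congr' (f₂ := fun _ => p.wronskian RL RR p.mid) (by
    filter_upwards [hev] with r hr
    rw [← hform r hr, wronskian_eq_wronskian_mid hLsol hRsol hr])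
  rw [tendsto_nhds_unique hconst hlim', hL1, hR1]
  have hBrm : (B p.rm : ℂ) = -(2 * p.κm * p.rm ^ 2) := by
    have : B p.rm = -(2 * p.κm * p.rm ^ 2) := by
      have h1 := p.l_pos.ne'
      have h2 := p.rm_pos.ne'
      rw [p.two_mul_κm, hB]
      field_simp
      ring
    rw [this]; push_cast; ring
  rw [hBrm, hρ]
  field_simp
  ring

theorem isRHR_RHR (p : RNAdS) {ω : ℂ} (hω : ω.re ≠ 0) (ℓ : ℕ) : p.IsRHR ω ℓ (p.RHR ω ℓ) := by
  have h := p.exists_isRHR hω ℓ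
  rw [RHR, dif_pos h]
  exact h.choose_spec

theorem isRCHL_RCHL (p : RNAdS) {ω : ℂ} (hω : ω.re ≠ 0) (ℓ : ℕ) : p.IsRCHL ω ℓ (p.RCHL ω ℓ) := by
  have h := p.exists_isRCHL hω ℓ
  rw [RCHL, dif_pos h]
  exact h.choose_spec

theorem isRCHR_RCHR (p : RNAdS) {ω : ℂ} (hω : ω.re ≠ 0) (ℓ : ℕ) : p.IsRCHR ω ℓ (p.RCHR ω ℓ) := by
  have h := p.exists_isRCHR hω ℓ
  rw [RCHR, dif_pos h]
  exact h.choose_spec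

/-- Ensures that `transmission` is not its default value $0$: the two Cauchy horizon solutions have
nonzero Wronskian, and Cramer's rule gives the coefficients. -/
theorem transmission_spec (p : RNAdS) {ω : ℂ} (hω : ω.re ≠ 0) (ℓ : ℕ) :
    ∃ R : ℂ, ∀ r ∈ Set.Ioo p.rm p.rp,
      p.uHR ω ℓ r = R * p.uCHR ω ℓ r + p.transmission ω ℓ * p.uCHL ω ℓ r := by
  have h : ∃ T : ℂ, ∃ R : ℂ, ∀ r ∈ Set.Ioo p.rm p.rp,
      p.uHR ω ℓ r = R * p.uCHR ω ℓ r + T * p.uCHL ω ℓ r := by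
    have hH := p.isRHR_RHR hω ℓ
    have hL := p.isRCHL_RCHL hω ℓ
    have hR := p.isRCHR_RCHR hω ℓ
    have hsub : Set.Ioo p.rm p.rp ⊆ Set.Ioi p.rm \ {p.rp} := fun r hr => ⟨hr.1, hr.2.ne⟩
    have hHsol : p.SolvesRadial ω ℓ (p.RHR ω ℓ) (Set.Ioo p.rm p.rp) :=
      ⟨hH.1.1.mono hsub, fun r hr => hH.1.2 r (hsub hr)⟩
    have hW := p.wronskian_RCHL_RCHR hL hR
    have hrm : (p.rm : ℂ) ≠ 0 := by exact_mod_cast p.rm_pos.ne'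
    have hrp : (p.rp : ℂ) ≠ 0 := by exact_mod_cast p.rp_pos.ne'
    have hω0 : ω ≠ 0 := fun h => hω (by simp [h])
    have hW0 : p.wronskian (p.RCHL ω ℓ) (p.RCHR ω ℓ) p.mid ≠ 0 := by
      rw [hW]
      exact mul_ne_zero (mul_ne_zero (mul_ne_zero two_ne_zero Complex.I_ne_zero) hω0)
        (pow_ne_zero 2 hrm)
    set w := p.wronskian (p.RCHL ω ℓ) (p.RCHR ω ℓ) p.mid with hw
    set w₁ := p.wronskian (p.RHR ω ℓ) (p.RCHR ω ℓ) p.mid with hw₁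
    set w₂ := p.wronskian (p.RCHL ω ℓ) (p.RHR ω ℓ) p.mid with hw₂
    set NH := (p.rp : ℂ) * Complex.exp (Complex.I * ω * (p.fstar p.rp : ℂ)) with hNH
    set NR := (p.rm : ℂ) * Complex.exp (-(Complex.I * ω * (p.gstar p.rm : ℂ))) with hNR
    set NL := (p.rm : ℂ) * Complex.exp (Complex.I * ω * (p.gstar p.rm : ℂ)) with hNL
    have nH : NH ≠ 0 := mul_ne_zero hrp (Complex.exp_ne_zero _)
    have nR : NR ≠ 0 := mul_ne_zero hrm (Complex.exp_ne_zero _)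
    have nL : NL ≠ 0 := mul_ne_zero hrm (Complex.exp_ne_zero _)
    refine ⟨w₁ / w * (NL / NH), w₂ / w * (NR / NH), fun r hr => ?_⟩
    have e := wronskian_eq_wronskian_mid hL.1 hR.1 hr
    have e₁ := wronskian_eq_wronskian_mid hHsol hR.1 hr
    have e₂ := wronskian_eq_wronskian_mid hL.1 hHsol hr
    have hcramer : p.RHR ω ℓ r * w = w₁ * p.RCHL ω ℓ r + w₂ * p.RCHR ω ℓ r := by
      rw [hw, hw₁, hw₂, ← e, ← e₁, ← e₂]
      unfold wronskian
      ring
    simp only [uHR, uCHR, uCHL]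
    rw [← hNH, ← hNR, ← hNL]
    field_simp
    linear_combination (r : ℂ) * hcramer
  rw [transmission, dif_pos h]
  exact h.choose_spec

/-- Pairing the decomposition with $R_{\mathcal{CH}_R}$ removes the reflected part, which also shows
that $\mathfrak T$ does not depend on the choice made. The exponential is the ratio of the
normalising factors of $u_{\mathcal H_R}$ and $u_{\mathcal{CH}_L}$, whose moduli differ from $r_\pm$
when $\omega$ is not real. -/
theorem norm_transmission (p : RNAdS) {ω : ℂ} (hω : ω.re ≠ 0) (ℓ : ℕ) :
    ‖p.wronskian (p.RHR ω ℓ) (p.RCHR ω ℓ) p.mid‖ * Real.exp (-ω.im * (p.gstar p.rm - p.fstar p.rp))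
      = ‖p.transmission ω ℓ‖ * (2 * ‖ω‖ * (p.rp * p.rm)) := by
  obtain ⟨R, hTR⟩ := p.transmission_spec hω ℓ
  have hH := p.isRHR_RHR hω ℓ
  have hL := p.isRCHL_RCHL hω ℓ
  have hR := p.isRCHR_RCHR hω ℓ
  have hW := p.wronskian_RCHL_RCHR hL hR
  set T := p.transmission ω ℓ
  have hrm : (p.rm : ℂ) ≠ 0 := by exact_mod_cast p.rm_pos.ne'
  have hrp : (p.rp : ℂ) ≠ 0 := by exact_mod_cast p.rp_pos.ne'
  simp only [uHR, uCHR, uCHL] at hTR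
  set NH := (p.rp : ℂ) * Complex.exp (Complex.I * ω * (p.fstar p.rp : ℂ)) with hNH
  set NR := (p.rm : ℂ) * Complex.exp (-(Complex.I * ω * (p.gstar p.rm : ℂ))) with hNR
  set NL := (p.rm : ℂ) * Complex.exp (Complex.I * ω * (p.gstar p.rm : ℂ)) with hNL
  have nH : NH ≠ 0 := mul_ne_zero hrp (Complex.exp_ne_zero _)
  have nR : NR ≠ 0 := mul_ne_zero hrm (Complex.exp_ne_zero _)
  have nL : NL ≠ 0 := mul_ne_zero hrm (Complex.exp_ne_zero _)
  have hdec : ∀ r ∈ Set.Ioo p.rm p.rp,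
      p.RHR ω ℓ r = R * NH / NR * p.RCHR ω ℓ r + T * NH / NL * p.RCHL ω ℓ r := by
    intro r hr
    have hr0 : (r : ℂ) ≠ 0 := by exact_mod_cast (p.rm_pos.trans hr.1).ne'
    have h1 := hTR r hr
    refine mul_left_cancel₀ (div_ne_zero hr0 nH) ?_
    rw [h1]
    field_simp
  have hderiv : deriv (p.RHR ω ℓ) p.mid = R * NH / NR * deriv (p.RCHR ω ℓ) p.mid
      + T * NH / NL * deriv (p.RCHL ω ℓ) p.mid := by
    have h1 := ((hR.1.hasDerivAt isOpen_Ioo p.mid_mem).const_mul (R * NH / NR)).add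
      ((hL.1.hasDerivAt isOpen_Ioo p.mid_mem).const_mul (T * NH / NL))
    refine (h1.congr_of_eventuallyEq ?_).deriv
    filter_upwards [isOpen_Ioo.mem_nhds p.mid_mem] with r hr
    exact hdec r hr
  have hW' : p.wronskian (p.RHR ω ℓ) (p.RCHR ω ℓ) p.mid * NL
      = T * NH * (2 * Complex.I * ω * p.rm ^ 2) := by
    rw [← hW]
    unfold wronskian
    rw [hderiv, hdec _ p.mid_mem]
    field_simp
    ring
  have hexp : ∀ t : ℝ, ‖Complex.exp (Complex.I * ω * (t : ℂ))‖ = Real.exp (-ω.im * t) := by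
    intro t
    rw [Complex.norm_exp]
    congr 1
    simp [Complex.mul_re, Complex.mul_im]
  have hn := congrArg norm hW'
  rw [hNL, hNH] at hn
  simp only [norm_mul, norm_pow, Complex.norm_I, Complex.norm_ofNat, Complex.norm_real, hexp,
    Real.norm_of_nonneg p.rm_pos.le, Real.norm_of_nonneg p.rp_pos.le] at hn
  have hsub : Real.exp (-ω.im * (p.gstar p.rm - p.fstar p.rp)) * Real.exp (-ω.im * p.fstar p.rp)
      = Real.exp (-ω.im * p.gstar p.rm) := by
    rw [← Real.exp_add]; ring_nf
  rw [← hsub] at hn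
  have hpos : p.rm * Real.exp (-ω.im * p.fstar p.rp) ≠ 0 :=
    mul_ne_zero p.rm_pos.ne' (Real.exp_pos _).ne'
  refine mul_right_cancel₀ hpos ?_
  linear_combination hn

theorem exists_transmission_lower_bound (p : RNAdS) {a : ℝ} (ha : 0 < a) :
    ∃ η lam₀ : ℝ, 0 < η ∧ ∀ ℓ : ℕ, 1 ≤ ℓ → lam₀ ≤ ℓ → ∀ ω : ℂ, a * ℓ ≤ ω.re → ω.im ≤ 0 →
      -ω.im ≤ η → Real.exp (-1) / 4 ≤ ‖p.transmission ω ℓ‖ := by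
  obtain ⟨s, D, m₀, lam₀, hD, hm₀, hmain⟩ := p.exists_wronskian_lower_bound
  set g := p.gstar p.rm - p.fstar p.rp
  -- In this order the four bounds on $-\operatorname{Im}\omega$ meet the smallness condition at the
  -- horizons, keep the flux error below $\operatorname{Re}\omega/2$ (using
  -- $\sqrt{\ell(\ell+1)}\le2\ell$), give $|\omega|\le2\operatorname{Re}\omega$, and keep the
  -- exponential factors above $e^{-1}$.
  refine ⟨min (min (m₀ / 4) (a / (4 * D))) (min a (1 / (1 + |g - s|))), lam₀, by positivity, ?_⟩
  intro ℓ hℓ hlam ω hre him hη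
  have hℓ' : (1 : ℝ) ≤ ℓ := by exact_mod_cast hℓ
  have h1 : -ω.im ≤ m₀ / 4 := hη.trans ((min_le_left _ _).trans (min_le_left _ _))
  have h2 : -ω.im ≤ a / (4 * D) := hη.trans ((min_le_left _ _).trans (min_le_right _ _))
  have h3 : -ω.im ≤ a := hη.trans ((min_le_right _ _).trans (min_le_left _ _))
  have h4 : -ω.im ≤ 1 / (1 + |g - s|) := hη.trans ((min_le_right _ _).trans (min_le_right _ _))
  have hre0 : 0 < ω.re := (by positivity : 0 < a * ℓ).trans_le hre
  have hsqrt : Real.sqrt ((ℓ : ℝ) * (ℓ + 1)) ≤ 2 * ℓ := by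
    rw [Real.sqrt_le_left (by positivity)]
    nlinarith
  have hsmall : D * -ω.im * Real.sqrt ((ℓ : ℝ) * (ℓ + 1)) ≤ ω.re / 2 := by
    rw [le_div_iff₀ (by positivity)] at h2
    have h5 : 0 ≤ D * -ω.im := mul_nonneg hD.le (by linarith)
    nlinarith [mul_le_mul_of_nonneg_left hsqrt h5]
  have hWr := hmain ℓ (by nlinarith) ω him (by linarith) hsmall _ _ (p.isRHR_RHR hre0.ne' ℓ)
    (p.isRCHR_RCHR hre0.ne' ℓ)
  have hT := p.norm_transmission hre0.ne' ℓ
  have hprod : 0 < p.rp * p.rm := mul_pos p.rp_pos p.rm_pos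
  have hω : ‖ω‖ ≤ 2 * ω.re := by
    refine (Complex.norm_le_abs_re_add_abs_im ω).trans ?_
    rw [abs_of_pos hre0, abs_of_nonpos him]
    nlinarith
  have hexp : Real.exp (-1) ≤ Real.exp (-(-ω.im * s)) * Real.exp (-ω.im * g) := by
    rw [← Real.exp_add, Real.exp_le_exp]
    rw [le_div_iff₀ (by positivity)] at h4
    have h6 : -ω.im * -|g - s| ≤ -ω.im * (g - s) :=
      mul_le_mul_of_nonneg_left (neg_abs_le _) (by linarith)
    nlinarith
  have h7 : Real.exp (-1) * (ω.re * (p.rp * p.rm))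
      ≤ ‖p.transmission ω ℓ‖ * (2 * (2 * ω.re) * (p.rp * p.rm)) := by
    calc _ ≤ (Real.exp (-(-ω.im * s)) * Real.exp (-ω.im * g)) * (ω.re * (p.rp * p.rm)) := by
          gcongr
      _ = Real.exp (-(-ω.im * s)) * (ω.re * (p.rp * p.rm)) * Real.exp (-ω.im * g) := by ring
      _ ≤ ‖p.wronskian (p.RHR ω ℓ) (p.RCHR ω ℓ) p.mid‖ * Real.exp (-ω.im * g) := by gcongr
      _ = _ := hT
      _ ≤ _ := by gcongr
  rw [div_le_iff₀ (by norm_num)]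
  have h8 : 0 < ω.re * (p.rp * p.rm) := by positivity
  refine le_of_mul_le_mul_right ?_ h8
  linarith

end RNAdS

end

theorem mainTheorem2 (p : RNAdS) (a b C c : ℝ) (ha : 0 < a) (hb : 0 < b) (hC : 0 < C)
    (hc : 0 < c) :
    ∃ δ : ℝ, 0 < δ ∧ ∃ L : ℕ, ∀ (ℓ₀ : ℕ) (ω : ℕ → ℂ),
      (∀ ℓ : ℕ, ℓ₀ ≤ ℓ →
        p.IsQuasinormalFrequency (ω ℓ) ℓ ∧
        a * (ℓ : ℝ) ≤ (ω ℓ).re ∧ (ω ℓ).re ≤ b * (ℓ : ℝ) ∧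
        0 < -(ω ℓ).im ∧ -(ω ℓ).im ≤ C * Real.exp (-c * (ℓ : ℝ))) →
      ∀ ℓ : ℕ, ℓ₀ ≤ ℓ → L ≤ ℓ → δ ≤ ‖p.transmission (ω ℓ) ℓ‖ := by
  obtain ⟨η, lam₀, hη, hbound⟩ := p.exists_transmission_lower_bound ha
  have hlim : Filter.Tendsto (fun ℓ : ℕ => C * Real.exp (-c * (ℓ : ℝ))) Filter.atTop (𝓝 0) := by
    have h1 : Filter.Tendsto (fun ℓ : ℕ => c * (ℓ : ℝ)) Filter.atTop Filter.atTop :=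
      tendsto_natCast_atTop_atTop.const_mul_atTop hc
    have h2 := ((Real.tendsto_exp_neg_atTop_nhds_zero.comp h1).const_mul C)
    rw [mul_zero] at h2
    refine h2.congr fun ℓ => ?_
    simp only [Function.comp, neg_mul]
  obtain ⟨N, hN⟩ := Filter.eventually_atTop.1 (hlim.eventually_le_const hη)
  obtain ⟨N', hN'⟩ := exists_nat_ge lam₀
  refine ⟨Real.exp (-1) / 4, by positivity, max (max 1 N) N', fun ℓ₀ ω h ℓ hℓ hL => ?_⟩
  obtain ⟨-, hre, -, him, him'⟩ := h ℓ hℓ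
  have h1 : 1 ≤ ℓ := ((le_max_left _ _).trans (le_max_left _ _)).trans hL
  have h2 : N ≤ ℓ := ((le_max_right _ _).trans (le_max_left _ _)).trans hL
  have h3 : N' ≤ ℓ := (le_max_right _ _).trans hL
  exact hbound ℓ h1 (hN'.trans (by exact_mod_cast h3)) (ω ℓ) hre (by linarith)
    (him'.trans (hN ℓ h2))
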